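/- **Conventions.** Here $\mathbb{N}=\{1,2,3,\dots\}$. For groups $\Gamma,Q$ and $F\subseteq\Gamma$, a *local embedding* of $F$ into $Q$ is an injective map $\phi:F\to Q$ with $\phi(gh)=\phi(g)\phi(h)$ whenever $g,h,gh\in F$. $\Gamma$ is *LEF* if every finite subset of $\Gamma$ has a local embedding into some finite group. If $\Gamma$ is LEF and generated by a finite set $S$, then $B_S(n)$ is the set of elements of word length at most $n$ with respect to $S$, and the *LEF growth* $\mathcal{L}^S_\Gamma(n)$ is the least order of a finite group into which $B_S(n)$ has a local embedding. For functions $F_1,F_2$ on $\mathbb{N}$, $F_1\preceq F_2$ means that there is $K\in\mathbb{N}$ with $F_1(n)\le F_2(Kn)$ for all $n\in\mathbb{N}$. Let $A$ be a finite alphabet with at least two letters, and give $A^{\mathbb{Z}}$ the product topology and the shift $\sigma(a)_i=a_{i+1}$. For $\mathbf{x}\in A^{\mathbb{Z}}$ let $p_{\mathbf{x}}(n)$ be the number of factors of $\mathbf{x}$ of length $n$. The word $\mathbf{x}$ is *uniformly recurrent* if for every $n$ there is $M$ such that every factor of $\mathbf{x}$ of length $M$ contains every factor of $\mathbf{x}$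 of length $n$; the least such $M$ is $R_{\mathbf{x}}(n)$. If $\mathbf{x}$ is uniformly recurrent and not periodic, the closure $X$ of its $\sigma$-orbit is called a *minimal subshift*; $p_{\mathbf{x}}$ and $R_{\mathbf{x}}$ depend only on $X$ and are written $p_X$ and $R_X$. The *topological full group* $[\![\sigma]\!]$ of $(X,\sigma)$ is the group of homeomorphisms $g$ of $X$ for which there is a continuous $f:X\to\mathbb{Z}$ with $g(y)=\sigma^{f(y)}(y)$ for all $y\in X$, and $[\![\sigma]\!]'$ is its derived subgroup. **Theorem.** For every real $r\ge 2$ there is a minimal subshift $X_r$ over a finite alphabet such that - there is $C>0$ with $R_{X_r}(n)\le\exp\big(C(\log n)^r\big)$ for all $n\ge 2$, and there are $c>0$ and a strictly increasing sequence $(m_i)$ of positive integers with $p_{X_r}(m_i)\ge\exp\big(c(\log m_i)^r\big)$ for all $i$; and such that the group $\Gamma^{(r)}=[\![\sigma]\!]'$ of $(X_r,\sigma)$ is finitely generated and LEF and satisfies - (i) there is $C_r>0$ such that, for every finite generating set $S$ of $\Gamma^{(r)}$, $\mathcal{L}^S_{\Gamma^{(r)}}(n)\preceq\exp\big(\exp(C_r(\log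 n)^r)\big)$; - (ii) for every real $r'$ with $2\le r'<r$, every $C>0$ and every finite generating set $S$ of $\Gamma^{(r)}$, $\mathcal{L}^S_{\Gamma^{(r)}}(n)\not\preceq\exp\big(\exp(C(\log n)^{r'})\big)$. -/

import Mathlib

open Topology

/-! ## Locally embeddable into finite groups -/

/-- `φ`, restricted to `F`, is a local embedding of `F`: an injective partial homomorphism.
(The values of `φ` outside `F` are irrelevant.) -/
def IsLocalEmbedding {G Q : Type*} [Group G] [Group Q] (F : Set G) (φ : G → Q) : Prop :=
  Set.InjOn φ F ∧ ∀ g ∈ F, ∀ h ∈ F, g * h ∈ F → φ (g * h) = φ g * φ h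

/-- `G` is locally embeddable into finite groups. -/
def IsLEF (G : Type*) [Group G] : Prop :=
  ∀ F : Set G, F.Finite →
    ∃ (Q : Type) (_ : Group Q) (_ : Finite Q) (φ : G → Q), IsLocalEmbedding F φ

/-- The ball `B_S(n)`: the elements that are products of at most `n` elements of `S ∪ S⁻¹`. -/
def wordBall {G : Type*} [Group G] (S : Set G) (n : ℕ) : Set G :=
  {g | ∃ l : List G, l.length ≤ n ∧ (∀ s ∈ l, s ∈ S ∨ s⁻¹ ∈ S) ∧ l.prod = g}

/-- The LEF growth function: the least order of a finite group into which `B_S(n)` locally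
embeds. -/
noncomputable def lefGrowth {G : Type*} [Group G] (S : Set G) (n : ℕ) : ℕ :=
  sInf {m : ℕ | ∃ (Q : Type) (_ : Group Q) (_ : Finite Q) (φ : G → Q),
    IsLocalEmbedding (wordBall S n) φ ∧ Nat.card Q = m}

/-- `F₁ ⪯ F₂` for functions on the positive integers: domination up to rescaling of the
argument. -/
def GrowthLE (F₁ F₂ : ℕ → ℝ) : Prop :=
  ∃ K : ℕ, 0 < K ∧ ∀ n : ℕ, 1 ≤ n → F₁ n ≤ F₂ (K * n)

/-! ## Bi-infinite words -/

/-- The set of `n`-factors of a bi-infinite word. -/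
def factors {A : Type*} (x : ℤ → A) (n : ℕ) : Set (Fin n → A) :=
  {v | ∃ k : ℤ, ∀ i : Fin n, v i = x (k + (i : ℕ))}

/-- The set of `n`-factors of a finite word of length `M`. -/
def wordFactors {A : Type*} {M : ℕ} (v : Fin M → A) (n : ℕ) : Set (Fin n → A) :=
  {w | ∃ (k : ℕ) (hk : k + n ≤ M), ∀ i : Fin n,
    w i = v ⟨k + i, lt_of_lt_of_le (Nat.add_lt_add_left i.isLt k) hk⟩}

/-- The complexity function. -/
noncomputable def complexity {A : Type*} (x : ℤ → A) (n : ℕ) : ℕ :=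
  (factors x n).ncard

/-- Every `M`-factor of `x` contains every `n`-factor of `x`. -/
def RecursWithin {A : Type*} (x : ℤ → A) (n M : ℕ) : Prop :=
  ∀ w ∈ factors x n, ∀ v ∈ factors x M, w ∈ wordFactors v n

/-- Uniform recurrence. -/
def IsUniformlyRecurrent {A : Type*} (x : ℤ → A) : Prop :=
  ∀ n : ℕ, ∃ M : ℕ, RecursWithin x n M

/-- The recurrence function: the least `M` such that every `M`-factor contains every
`n`-factor. -/
noncomputable def recurrence {A : Type*} (x : ℤ → A) (n : ℕ) : ℕ :=
  sInf {M : ℕ | RecursWithin x n M}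

/-! ## Subshifts and topological full groups -/

/-- The shift `σ(a)_i = a_{i+1}` on `A^ℤ`. -/
def fullShift (A : Type*) [TopologicalSpace A] : (ℤ → A) ≃ₜ (ℤ → A) where
  toFun a i := a (i + 1)
  invFun a i := a (i - 1)
  left_inv a := by funext i; simp
  right_inv a := by funext i; simp
  continuous_toFun := continuous_pi fun i => continuous_apply (i + 1)
  continuous_invFun := continuous_pi fun i => continuous_apply (i - 1)

/-- The orbit of `x` under the shift. -/
def shiftOrbit {A : Type*} [TopologicalSpace A] (x : ℤ → A) : Set (ℤ → A) :=
  Set.range fun k : ℤ => (fullShift A ^ k) x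

/-- The closure of the orbit of `x` under the shift. -/
def orbitClosure {A : Type*} [TopologicalSpace A] (x : ℤ → A) : Set (ℤ → A) :=
  closure (shiftOrbit x)

/-- The word `x` is non-periodic. -/
def IsNonperiodic {A : Type*} (x : ℤ → A) : Prop :=
  ∀ k : ℤ, k ≠ 0 → ∃ i : ℤ, x (i + k) ≠ x i

theorem mem_orbitClosure_iff {A : Type*} [TopologicalSpace A] (x y : ℤ → A) :
    y ∈ orbitClosure x ↔ fullShift A y ∈ orbitClosure x := by
  have himg : fullShift A '' shiftOrbit x = shiftOrbit x := by
    ext z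
    constructor
    · rintro ⟨_, ⟨k, rfl⟩, rfl⟩
      refine ⟨1 + k, ?_⟩
      simp only [zpow_add, zpow_one]
      rfl
    · rintro ⟨k, rfl⟩
      refine ⟨(fullShift A ^ (-1 + k)) x, ⟨-1 + k, rfl⟩, ?_⟩
      have h : fullShift A ^ k = fullShift A * fullShift A ^ (-1 + k) := by
        rw [zpow_add, zpow_neg_one, mul_inv_cancel_left]
      simp only [h]
      rfl
  have hcl : fullShift A '' orbitClosure x = orbitClosure x := by
    unfold orbitClosure
    rw [(fullShift A).image_closure, himg]
  constructor
  · intro hy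
    rw [← hcl]
    exact Set.mem_image_of_mem _ hy
  · intro hy
    rw [← hcl] at hy
    obtain ⟨z, hz, hzy⟩ := hy
    rwa [← (fullShift A).injective hzy]

/-- The shift restricted to the orbit closure of `x`. -/
def subshift {A : Type*} [TopologicalSpace A] (x : ℤ → A) :
    orbitClosure x ≃ₜ orbitClosure x :=
  (fullShift A).subtype (mem_orbitClosure_iff x)

/-- The topological full group of a homeomorphism `φ` of `X`: all homeomorphisms `g` with
`g y = φ ^ (f y) y` for a continuous `f : X → ℤ`. -/
def topologicalFullGroup {X : Type*} [TopologicalSpace X] (φ : X ≃ₜ X) : Subgroup (X ≃ₜ X) where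
  carrier := {g | ∃ f : X → ℤ, Continuous f ∧ ∀ y, g y = (φ ^ f y) y}
  one_mem' := ⟨fun _ => 0, continuous_const, fun y => by simp⟩
  mul_mem' := by
    rintro g h ⟨a, ha, hga⟩ ⟨b, hb, hhb⟩
    refine ⟨fun y => a (h y) + b y, (ha.comp h.continuous).add hb, fun y => ?_⟩
    change g (h y) = _
    rw [hga (h y), zpow_add]
    change _ = (φ ^ a (h y)) ((φ ^ b y) y)
    rw [← hhb y]
  inv_mem' := by
    rintro g ⟨a, ha, hga⟩
    refine ⟨fun y => - a (g⁻¹ y), (ha.comp (g⁻¹).continuous).neg, fun y => ?_⟩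
    have h1 : g (g⁻¹ y) = y := g.apply_symm_apply y
    have h2 := hga (g⁻¹ y)
    rw [h1] at h2
    have h3 : (φ ^ (-a (g⁻¹ y))) ((φ ^ a (g⁻¹ y)) (g⁻¹ y)) = g⁻¹ y := by
      rw [zpow_neg]
      exact (φ ^ a (g⁻¹ y)).symm_apply_apply _
    rw [← h2] at h3
    exact h3.symm

/-- The derived subgroup of the topological full group of the subshift generated by `x`. -/
abbrev DerivedFullGroup {A : Type*} [TopologicalSpace A] (x : ℤ → A) : Type _ :=
  commutator (topologicalFullGroup (subshift x))

/-!
The word `X_r` is a Toeplitz word built from levels of blocks. At level `i` the word is a sequence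
of two kinds of blocks of the same length `P_i` (`period M i`), which differ only in their first
letter, the hole; the letters in the holes form a binary Toeplitz sequence again (`skeleton M i`).
One block of level `i + 1` lists all binary words of length `M_i` in its holes. Hence every word
of length about `M_i * P_i` recurs within `2 * P_(i + 1)` (`recursWithin_toeplitz`), there are at
least `2 ^ M_i` words of length `M_i * P_i` (`two_pow_le_complexity_toeplitz`), and windows of `x`
determine positions modulo `P_i` (`period_dvd_of_toeplitz_eq`). Taking `M_i` alternately equal to
`2` and of the order of magnitude `(log P_i) ^ r` makes recurrence and complexity as large as
`exp ((log n) ^ r)`, up to constants in the exponent, but not larger.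

The topological full group acts faithfully on the orbit of `x`. This identifies it with the group
`localGroup x` of those permutations of `ℤ` whose displacement at `k` is determined by a window of
`x` around `k` (`range_orbitHom`), and all further arguments take place in `Equiv.Perm ℤ`.

Its derived subgroup is generated by finitely many three-cycles (`commutator_localGroup_eq`).
First, any local permutation can be corrected by local three-cycles so that it is supported near
the multiples of a large period `P`; two such permutations commute after one of them has been
conjugated by a further three-cycle, so the local group is abelian modulo three-cycles
(`commutator_localGroup_le`). Secondly, the commutator of two three-cycles over sets `V` and `W`
that meet in one point of each orbit is a three-cycle over `V ∩ W` (`IsCyc.commutator`), so the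
three-cycles of long cylinders are obtained from those of short ones; doubling the length of the
word in each step keeps the word length polynomial (`exists_isCyc_cylinder_mem_wordBall`).

Lower bound: for words with the same first letter, the pairs of overlapping three-cycles over the
cylinders commute for different words but not for the same word. A finite group into which a ball
containing them embeds locally has at least `2 ^ q` elements, `q` being the number of these words
(`exists_two_pow_le_card_of_isLocalEmbedding`). Upper bound: a ball of radius `n` acts on a
periodic approximation of `x` whose period is at most twice the recurrence function at a multiple
of `n`, and so embeds locally into a symmetric group (`exists_isLocalEmbedding_wordBall`).
-/

/-! ### A Toeplitz word -/

/-- The length of the blocks of parameter `M`: one hole, the `2 ^ M` binary words of length `M`, and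
one padding letter. -/
def blockLength (M : ℕ) : ℕ := M * 2 ^ M + 2

/-- The letter at position `j ≥ 1` of the block of parameter `M`: after the hole at position `0`, the
block lists the binary expansions (of length `M`) of `0, 1, …, 2 ^ M - 1`. -/
def blockFill (M j : ℕ) : Bool := ((j - 1) / M).testBit ((j - 1) % M)

theorem two_le_blockLength (M : ℕ) : 2 ≤ blockLength M := by
  unfold blockLength; omega

theorem blockFill_apply {M c t : ℕ} (ht : t < M) : blockFill M (1 + M * c + t) = c.testBit t := by
  have h : 1 + M * c + t - 1 = t + M * c := by omega
  rw [blockFill, h, Nat.add_mul_div_left _ _ (by omega), Nat.add_mul_mod_self_left,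
    Nat.div_eq_of_lt ht, Nat.mod_eq_of_lt ht, zero_add]

/-- The Toeplitz sequence of level `i` with block parameters `M i, M (i + 1), …`: the holes, at the
multiples of `blockLength (M i)`, carry the sequence of level `i + 1`. -/
def skeleton (M : ℕ → ℕ) (i : ℕ) (m : ℤ) : Bool :=
  if m = 0 then false
  else if (blockLength (M i) : ℤ) ∣ m then skeleton M (i + 1) (m / blockLength (M i))
  else blockFill (M i) (m % blockLength (M i)).toNat
termination_by m.natAbs
decreasing_by
  rename_i h0 hd
  obtain ⟨q, rfl⟩ := hd
  have h2 := two_le_blockLength (M i)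
  have hK : (blockLength (M i) : ℤ) ≠ 0 := by omega
  rw [Int.mul_ediv_cancel_left _ hK, Int.natAbs_mul]
  have hq : 0 < q.natAbs := by
    rw [Int.natAbs_pos]; rintro rfl; simp at h0
  have : ((blockLength (M i) : ℤ)).natAbs = blockLength (M i) := Int.natAbs_natCast _
  rw [this]
  nlinarith

theorem skeleton_zero (M : ℕ → ℕ) (i : ℕ) : skeleton M i 0 = false := by
  rw [skeleton]; simp

theorem skeleton_hole (M : ℕ → ℕ) (i : ℕ) (q : ℤ) :
    skeleton M i (blockLength (M i) * q) = skeleton M (i + 1) q := by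
  have h2 := two_le_blockLength (M i)
  have hK : (blockLength (M i) : ℤ) ≠ 0 := by omega
  by_cases hq : q = 0
  · subst hq; simp [skeleton_zero]
  · rw [skeleton, if_neg (mul_ne_zero hK hq), if_pos (dvd_mul_right _ _),
      Int.mul_ediv_cancel_left _ hK]

theorem skeleton_fill (M : ℕ → ℕ) (i : ℕ) (q : ℤ) {j : ℕ} (h0 : 0 < j)
    (hj : j < blockLength (M i)) :
    skeleton M i (blockLength (M i) * q + j) = blockFill (M i) j := by
  have hmod : (blockLength (M i) * q + j : ℤ) % blockLength (M i) = j := by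
    rw [add_comm, Int.add_mul_emod_self_left]
    exact Int.emod_eq_of_lt (by omega) (by omega)
  have hnd : ¬ (blockLength (M i) : ℤ) ∣ (blockLength (M i) * q + j) := by
    rw [Int.dvd_iff_emod_eq_zero, hmod]; omega
  rw [skeleton, if_neg (fun h => hnd (by rw [h]; exact dvd_zero _)), if_neg hnd, hmod, Int.toNat_natCast]

/-- Every binary word of length `M i` occurs in every block of level `i`, at a position which does not
depend on the block. -/
theorem exists_skeleton_eq (M : ℕ → ℕ) (i : ℕ) (b : ℕ → Bool) :
    ∃ c : ℕ, c + M i ≤ blockLength (M i) ∧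
      ∀ q : ℤ, ∀ t < M i, skeleton M i (blockLength (M i) * q + c + t) = b t := by
  let d := Nat.ofBits (fun t : Fin (M i) => b t)
  have hd : d + 1 ≤ 2 ^ M i := Nat.ofBits_lt_two_pow _
  have hmul : M i * (d + 1) ≤ M i * 2 ^ M i := Nat.mul_le_mul_left _ hd
  refine ⟨1 + M i * d, ?_, fun q t ht => ?_⟩
  · rw [blockLength]; linarith
  · have h := skeleton_fill M i q (j := 1 + M i * d + t) (by omega)
      (by rw [blockLength]; linarith)
    rw [blockFill_apply ht, Nat.testBit_ofBits_lt _ _ ht] at h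
    rw [← h]; push_cast; ring_nf

/-- The period of the part of the Toeplitz word that is filled in at levels below `i`. -/
def period (M : ℕ → ℕ) : ℕ → ℕ
  | 0 => 7
  | i + 1 => period M i * blockLength (M i)

theorem period_pos (M : ℕ → ℕ) (i : ℕ) : 0 < period M i := by
  induction i with
  | zero => simp [period]
  | succ i ih => exact Nat.mul_pos ih (by have := two_le_blockLength (M i); omega)

theorem two_mul_period_le (M : ℕ → ℕ) (i : ℕ) : 2 * period M i ≤ period M (i + 1) := by
  rw [period, mul_comm]
  exact Nat.mul_le_mul_left _ (two_le_blockLength _)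

theorem lt_period (M : ℕ → ℕ) (i : ℕ) : i < period M i := by
  induction i with
  | zero => simp [period]
  | succ i ih => have := two_mul_period_le M i; omega

theorem period_strictMono (M : ℕ → ℕ) : StrictMono (period M) := by
  refine strictMono_nat_of_lt_succ fun i => ?_
  have := two_mul_period_le M i
  have := period_pos M i
  omega

/-- The two letters that can stand in a hole. -/
def holeLetter (b : Bool) : Fin 8 := if b then 7 else 0

theorem holeLetter_injective : Function.Injective holeLetter := by decide

/-- The Toeplitz word over eight letters: the word `0 1 2 3 4 5 6` repeated, in which some of the
letters `0` are replaced by `7` as `skeleton M 0` prescribes. Any seven consecutive letters are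
distinct. -/
def toeplitz (M : ℕ → ℕ) (m : ℤ) : Fin 8 :=
  if 7 ∣ m then holeLetter (skeleton M 0 (m / 7)) else Fin.ofNat 8 (m % 7).toNat

theorem toeplitz_mod_seven (M : ℕ → ℕ) (m : ℤ) : ((toeplitz M m : ℕ) : ℤ) % 7 = m % 7 := by
  unfold toeplitz
  split_ifs with h
  · rw [Int.dvd_iff_emod_eq_zero.1 h]
    cases skeleton M 0 (m / 7) <;> simp [holeLetter]
  · simp only [Fin.ofNat]
    omega

/-- A letter determines its position modulo `7`. -/
theorem seven_dvd_of_toeplitz_eq (M : ℕ → ℕ) {k l : ℤ} (h : toeplitz M k = toeplitz M l) :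
    7 ∣ k - l := by
  have h1 := toeplitz_mod_seven M k
  have h2 := toeplitz_mod_seven M l
  rw [h] at h1
  omega

theorem toeplitz_hole (M : ℕ → ℕ) (i : ℕ) (q : ℤ) :
    toeplitz M (period M i * q) = holeLetter (skeleton M i q) := by
  induction i generalizing q with
  | zero => simp [period, toeplitz]
  | succ i ih => rw [period, Nat.cast_mul, mul_assoc, ih, skeleton_hole]

theorem toeplitz_add_period_mul (M : ℕ → ℕ) (i : ℕ) {m : ℤ} (hm : ¬ (period M i : ℤ) ∣ m) (t : ℤ) :
    toeplitz M (m + period M i * t) = toeplitz M m := by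
  induction i generalizing m t with
  | zero =>
    have h7 : ¬ (7 : ℤ) ∣ m := hm
    have h7' : ¬ (7 : ℤ) ∣ m + 7 * t := by omega
    have : (m + 7 * t) % 7 = m % 7 := by omega
    simp [period, toeplitz, h7, h7']
  | succ i ih =>
    by_cases hi : (period M i : ℤ) ∣ m
    · obtain ⟨q, rfl⟩ := hi
      have hK : 0 < (blockLength (M i) : ℤ) := by have := two_le_blockLength (M i); omega
      have hr0 : 0 ≤ q % blockLength (M i) := Int.emod_nonneg _ hK.ne'
      have hr1 : q % blockLength (M i) < blockLength (M i) := Int.emod_lt_of_pos _ hK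
      have hdm := Int.mul_ediv_add_emod q (blockLength (M i))
      have hr : 0 < q % blockLength (M i) := by
        refine lt_of_le_of_ne hr0 fun h => hm ?_
        rw [period, Nat.cast_mul]
        exact mul_dvd_mul_left _ (Int.dvd_iff_emod_eq_zero.2 h.symm)
      lift q % blockLength (M i) to ℕ using hr0 with j hj
      have key : ∀ q' : ℤ, toeplitz M (period M i * (blockLength (M i) * q' + j)) =
          holeLetter (blockFill (M i) j) := fun q' => by
        rw [toeplitz_hole, skeleton_fill _ _ _ (by omega) (by omega)]
      have h1 := key (q / blockLength (M i))
      have h2 := key (q / blockLength (M i) + t)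
      rw [hdm] at h1
      rw [h1, ← h2, period]
      congr 1
      push_cast
      nth_rewrite 1 [← hdm]
      ring
    · rw [period, Nat.cast_mul, mul_assoc, ih hi]

/-- The word is determined on a union of consecutive blocks by the letters in the holes. -/
theorem toeplitz_eq_of_skeleton_eq (M : ℕ → ℕ) (i n : ℕ) {q r : ℤ}
    (h : ∀ t < n, skeleton M i (q + t) = skeleton M i (r + t)) {s : ℕ} (hs : s < n * period M i) :
    toeplitz M (period M i * q + s) = toeplitz M (period M i * r + s) := by
  by_cases hd : (period M i : ℤ) ∣ s
  · obtain ⟨t, rfl⟩ := Int.natCast_dvd_natCast.1 hd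
    have ht : t < n := by
      rw [mul_comm] at hs
      exact lt_of_mul_lt_mul_right hs (Nat.zero_le _)
    rw [Nat.cast_mul, ← mul_add, ← mul_add, toeplitz_hole, toeplitz_hole, h t ht]
  · rw [add_comm, toeplitz_add_period_mul _ _ hd, add_comm, toeplitz_add_period_mul _ _ hd]

theorem recursWithin_toeplitz (M : ℕ → ℕ) (i : ℕ) {n : ℕ}
    (hn : n + period M i ≤ M i * period M i + 1) :
    RecursWithin (toeplitz M) n (2 * period M (i + 1)) := by
  have hP : (0 : ℤ) < period M i := by exact_mod_cast period_pos M i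
  have hP' : (0 : ℤ) < period M (i + 1) := by exact_mod_cast period_pos M (i + 1)
  rintro w ⟨k, hw⟩ v ⟨l, hv⟩
  -- The factor lies inside `M i` consecutive blocks of length `period M i`, starting with the block
  -- of index `q`; the same run of holes reappears in each block of the next level.
  have hj0 : 0 ≤ k % period M i := Int.emod_nonneg _ hP.ne'
  have hj1 : k % period M i < period M i := Int.emod_lt_of_pos _ hP
  have hk := Int.mul_ediv_add_emod k (period M i)
  set q := k / period M i
  lift k % period M i to ℕ using hj0 with j hj
  obtain ⟨c, hc, hskel⟩ := exists_skeleton_eq M i (fun t => skeleton M i (q + t))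
  have hl0 : 0 ≤ (-l) % period M (i + 1) := Int.emod_nonneg _ hP'.ne'
  have hl1 : (-l) % period M (i + 1) < period M (i + 1) := Int.emod_lt_of_pos _ hP'
  have hl := Int.mul_ediv_add_emod (-l) (period M (i + 1))
  set p := -((-l) / period M (i + 1)) with hp
  lift (-l) % period M (i + 1) to ℕ using hl0 with a ha
  have hpl : (period M (i + 1) : ℤ) * p = l + a := by rw [hp]; linarith
  have hcP : (c + M i) * period M i ≤ period M (i + 1) := by
    rw [period, mul_comm (period M i)]; exact Nat.mul_le_mul_right _ hc
  rw [add_mul] at hcP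
  have hjn : j + n ≤ M i * period M i := by omega
  refine ⟨a + c * period M i + j, by omega, fun s => ?_⟩
  have hs := s.isLt
  rw [hw, hv]
  have h := toeplitz_eq_of_skeleton_eq M i (M i) (q := q) (r := blockLength (M i) * p + c)
    (fun t ht => (hskel p t ht).symm) (s := j + s) (by omega)
  have e1 : (period M i * q + (j + s : ℕ) : ℤ) = k + s := by push_cast; linarith
  have e2 : (period M i * (blockLength (M i) * p + c) + (j + s : ℕ) : ℤ)
      = l + ((a + c * period M i + j + s : ℕ) : ℤ) := by
    have : (period M i * blockLength (M i) : ℤ) * p = l + a := by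
      rw [← hpl, period, Nat.cast_mul]
    push_cast
    linear_combination this
  rw [e1, e2] at h
  exact h

theorem two_pow_le_complexity_toeplitz (M : ℕ → ℕ) (i : ℕ) :
    2 ^ M i ≤ complexity (toeplitz M) (M i * period M i) := by
  choose c _ hc using exists_skeleton_eq M i
  let ext : (Fin (M i) → Bool) → ℕ → Bool := fun b t => if h : t < M i then b ⟨t, h⟩ else false
  let f : (Fin (M i) → Bool) → (Fin (M i * period M i) → Fin 8) := fun b s =>
    toeplitz M (period M i * c (ext b) + (s : ℕ))
  have hf : Function.Injective f := by
    intro b b' hbb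
    funext t
    have ht : (t : ℕ) * period M i < M i * period M i :=
      Nat.mul_lt_mul_of_pos_right t.isLt (period_pos M i)
    have h := congrFun hbb ⟨t * period M i, ht⟩
    have e : ∀ b, f b ⟨t * period M i, ht⟩ = holeLetter (b t) := fun b => by
      have h1 := hc (ext b) 0 t t.isLt
      simp only [mul_zero, zero_add] at h1
      change toeplitz M (period M i * c (ext b) + ((t * period M i : ℕ) : ℤ)) = _
      rw [Nat.cast_mul, mul_comm (t.val : ℤ), ← mul_add, toeplitz_hole, h1]
      simp [ext]
    rw [e, e] at h
    exact holeLetter_injective h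
  have hsub : Set.range f ⊆ factors (toeplitz M) (M i * period M i) := by
    rintro _ ⟨b, rfl⟩
    exact ⟨period M i * c (ext b), fun s => rfl⟩
  calc 2 ^ M i = (Set.range f).ncard := by
        rw [← Set.image_univ, Set.ncard_image_of_injective _ hf, Set.ncard_univ]
        simp
    _ ≤ _ := Set.ncard_le_ncard hsub (Set.toFinite _)

/-- Long windows determine positions modulo `period M i`: at positions in any other residue class the
filled-in part would be constant where the letters in the holes are not. -/
theorem period_dvd_of_toeplitz_eq (M : ℕ → ℕ) (i : ℕ) (hM : 1 ≤ M i) {k l : ℤ}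
    (h : ∀ s : ℕ, s ≤ 2 * period M (i + 1) → toeplitz M (k + s) = toeplitz M (l + s)) :
    (period M i : ℤ) ∣ k - l := by
  by_contra hkl
  have hP' : (0 : ℤ) < period M (i + 1) := by exact_mod_cast period_pos M (i + 1)
  have hl0 : 0 ≤ (-k) % period M (i + 1) := Int.emod_nonneg _ hP'.ne'
  have hl1 : (-k) % period M (i + 1) < period M (i + 1) := Int.emod_lt_of_pos _ hP'
  have hl := Int.mul_ediv_add_emod (-k) (period M (i + 1))
  set p := -((-k) / period M (i + 1)) with hp
  lift (-k) % period M (i + 1) to ℕ using hl0 with a ha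
  have hpk : (period M (i + 1) : ℤ) * p = k + a := by rw [hp]; linarith
  have hpk' : (period M i : ℤ) * (blockLength (M i) * p) = k + a := by
    rw [← hpk, period, Nat.cast_mul, mul_assoc]
  have hnd : ¬ (period M i : ℤ) ∣ l + a := fun hd => hkl <| by
    have : k - l = period M i * (blockLength (M i) * p) - (l + a) := by rw [hpk']; ring
    rw [this]
    exact dvd_sub (dvd_mul_right _ _) hd
  have key : ∀ b : Bool, holeLetter b = toeplitz M (l + a) := fun b => by
    obtain ⟨c, hc, hs⟩ := exists_skeleton_eq M i (fun _ => b)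
    have h1 := hs p 0 (by omega)
    have hcP : period M i * c ≤ period M (i + 1) := by
      rw [period]; exact Nat.mul_le_mul_left _ (by omega)
    have h2 := h (a + period M i * c) (by omega)
    have e1 : k + ((a + period M i * c : ℕ) : ℤ)
        = period M i * (blockLength (M i) * p + c + (0 : ℕ)) := by
      push_cast; linear_combination -hpk'
    rw [e1, toeplitz_hole, h1] at h2
    have e2 : l + ((a + period M i * c : ℕ) : ℤ) = (l + a) + period M i * c := by
      push_cast; ring
    rw [h2, e2, toeplitz_add_period_mul _ _ hnd]
  have := holeLetter_injective ((key true).trans (key false).symm)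
  exact absurd this (by decide)

/-! ### Choice of the block lengths -/

/-- The block parameter at level `i`, when the period reached so far is `P`. At even levels it is `2`,
so that all pairs of blocks recur quickly; at odd levels it is large, which creates complexity. -/
noncomputable def stepParam (r : ℝ) (i P : ℕ) : ℕ :=
  if Even i then 2 else ⌈Real.log P ^ r⌉₊ + 1

/-- The periods that result from the block parameters `stepParam r`. -/
noncomputable def stepPeriod (r : ℝ) : ℕ → ℕ
  | 0 => 7
  | i + 1 => stepPeriod r i * blockLength (stepParam r i (stepPeriod r i))

/-- The sequence of block parameters of the word `X_r`. -/
noncomputable def blockParam (r : ℝ) (i : ℕ) : ℕ := stepParam r i (stepPeriod r i)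

theorem period_blockParam (r : ℝ) (i : ℕ) : period (blockParam r) i = stepPeriod r i := by
  induction i with
  | zero => rfl
  | succ i ih => rw [period, stepPeriod, ih, blockParam]

theorem blockParam_of_even (r : ℝ) {i : ℕ} (hi : Even i) : blockParam r i = 2 := by
  rw [blockParam, stepParam, if_pos hi]

theorem blockParam_of_odd (r : ℝ) {i : ℕ} (hi : ¬ Even i) :
    blockParam r i = ⌈Real.log (period (blockParam r) i) ^ r⌉₊ + 1 := by
  rw [blockParam, stepParam, if_neg hi, period_blockParam]

theorem one_le_log_period (M : ℕ → ℕ) (i : ℕ) : 1 ≤ Real.log (period M i) := by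
  have h7 : 7 ≤ period M i := by
    have := (period_strictMono M).monotone (Nat.zero_le i)
    simpa [period] using this
  rw [Real.le_log_iff_exp_le (by exact_mod_cast period_pos M i)]
  have := Real.exp_one_lt_d9
  have h7' : (7 : ℝ) ≤ period M i := by exact_mod_cast h7
  linarith

theorem log_blockLength_le {M : ℕ} (hM : 1 ≤ M) : Real.log (blockLength M) ≤ 2 * M := by
  have h4 : blockLength M ≤ 4 ^ M := by
    unfold blockLength
    induction M, hM using Nat.le_induction with
    | base => norm_num
    | succ M hM ih =>
      have : 1 ≤ 2 ^ M := Nat.one_le_two_pow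
      rw [pow_succ, pow_succ]
      nlinarith
  rw [Real.log_le_iff_le_exp (by have := two_le_blockLength M; positivity)]
  have he : (4 : ℝ) ≤ Real.exp 2 := by
    have := Real.exp_one_gt_d9
    have h2 : Real.exp 2 = Real.exp 1 * Real.exp 1 := by rw [← Real.exp_add]; norm_num
    rw [h2]; nlinarith
  calc (blockLength M : ℝ) ≤ 4 ^ M := by exact_mod_cast h4
    _ ≤ Real.exp 2 ^ M := pow_le_pow_left₀ (by norm_num) he M
    _ = _ := by rw [← Real.exp_nat_mul]; ring_nf

theorem one_le_log_period_rpow {r : ℝ} (hr : 2 ≤ r) (M : ℕ → ℕ) (i : ℕ) : 1 ≤ Real.log (period M i) ^ r :=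
  Real.one_le_rpow (one_le_log_period M i) (by linarith)

theorem log_period_le_rpow {r : ℝ} (hr : 2 ≤ r) (M : ℕ → ℕ) (i : ℕ) :
    Real.log (period M i) ≤ Real.log (period M i) ^ r :=
  Real.self_le_rpow_of_one_le (one_le_log_period M i) (by linarith)

theorem two_le_blockParam {r : ℝ} (hr : 2 ≤ r) (i : ℕ) : 2 ≤ blockParam r i := by
  by_cases hi : Even i
  · rw [blockParam_of_even r hi]
  · rw [blockParam_of_odd r hi]
    have : 0 < ⌈Real.log (period (blockParam r) i) ^ r⌉₊ :=
      Nat.ceil_pos.2 (by linarith [one_le_log_period_rpow hr (blockParam r) i])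
    omega

theorem blockParam_le {r : ℝ} (hr : 2 ≤ r) (i : ℕ) :
    (blockParam r i : ℝ) ≤ 3 * Real.log (period (blockParam r) i) ^ r := by
  have h1 := one_le_log_period_rpow hr (blockParam r) i
  by_cases hi : Even i
  · rw [blockParam_of_even r hi]; push_cast; linarith
  · rw [blockParam_of_odd r hi]
    have := Nat.ceil_lt_add_one (a := Real.log (period (blockParam r) i) ^ r) (by linarith)
    push_cast; linarith

theorem log_period_succ (M : ℕ → ℕ) (i : ℕ) : Real.log (period M (i + 1)) =
    Real.log (period M i) + Real.log (blockLength (M i)) := by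
  have h1 : (period M i : ℝ) ≠ 0 := by exact_mod_cast (period_pos M i).ne'
  have h2 : (blockLength (M i) : ℝ) ≠ 0 := by
    have := two_le_blockLength (M i)
    exact_mod_cast (by omega : blockLength (M i) ≠ 0)
  rw [period, Nat.cast_mul, Real.log_mul h1 h2]

/-- Two levels up, the logarithm of the period has grown at most to its `r`-th power, because one of
the two levels has a block of bounded length. -/
theorem two_mul_period_le_exp {r : ℝ} (hr : 2 ≤ r) (i : ℕ) : (2 * period (blockParam r) (i + 2) : ℝ) ≤
    Real.exp ((12 + 6 * 5 ^ r) * Real.log (period (blockParam r) i) ^ r) := by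
  set M := blockParam r with hM
  have hM2 : ∀ i, 2 ≤ M i := two_le_blockParam hr
  have hP : (0 : ℝ) < period M (i + 2) := by exact_mod_cast period_pos M (i + 2)
  rw [← Real.log_le_iff_le_exp (by positivity), Real.log_mul (by norm_num) hP.ne',
    log_period_succ, log_period_succ]
  have h1 := one_le_log_period_rpow hr M i
  have hl := log_period_le_rpow hr M i
  have h0 := one_le_log_period M i
  have hlog2 : Real.log 2 ≤ 1 := by linarith [Real.log_two_lt_d9]
  have hA : Real.log (blockLength (M i)) ≤ 6 * Real.log (period M i) ^ r := by
    have := log_blockLength_le (M := M i) (by have := hM2 i; omega)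
    linarith [blockParam_le hr i]
  have h5 : (0 : ℝ) < 5 ^ r := by positivity
  have hB : Real.log (blockLength (M (i + 1))) ≤ (4 + 6 * 5 ^ r) * Real.log (period M i) ^ r := by
    have hK := log_blockLength_le (M := M (i + 1)) (by have := hM2 (i + 1); omega)
    by_cases hi : Even i
    · have hK' := log_blockLength_le (M := M i) (by have := hM2 i; omega)
      rw [show M i = 2 from blockParam_of_even r hi] at hK'
      have hs : Real.log (period M (i + 1)) ≤ 5 * Real.log (period M i) := by
        rw [log_period_succ, show M i = 2 from blockParam_of_even r hi]
        push_cast at hK'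
        linarith
      have hs' : Real.log (period M (i + 1)) ^ r ≤ 5 ^ r * Real.log (period M i) ^ r := by
        rw [← Real.mul_rpow (by norm_num) (by linarith)]
        exact Real.rpow_le_rpow (by linarith [one_le_log_period M (i + 1)]) hs (by linarith)
      have := blockParam_le hr (i + 1)
      nlinarith
    · rw [show M (i + 1) = 2 from blockParam_of_even r (by grind)] at hK ⊢
      push_cast at hK
      nlinarith [mul_pos h5 (by linarith : (0 : ℝ) < Real.log (period M i) ^ r)]
  linarith

theorem isUniformlyRecurrent_toeplitz {r : ℝ} (hr : 2 ≤ r) : IsUniformlyRecurrent (toeplitz (blockParam r)) := by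
  intro n
  refine ⟨_, recursWithin_toeplitz (blockParam r) n ?_⟩
  have h1 := two_le_blockParam hr n
  have h2 := lt_period (blockParam r) n
  nlinarith

theorem isNonperiodic_toeplitz {r : ℝ} (hr : 2 ≤ r) : IsNonperiodic (toeplitz (blockParam r)) := by
  intro k hk
  by_contra! h
  have hd := period_dvd_of_toeplitz_eq (blockParam r) k.natAbs (k := k) (l := 0)
    (by have := two_le_blockParam hr k.natAbs; omega) (fun s _ => by
      rw [zero_add, add_comm]; exact h s)
  rw [sub_zero] at hd
  have h1 := Int.natAbs_dvd_natAbs.2 hd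
  rw [Int.natAbs_natCast] at h1
  have h2 := Nat.le_of_dvd (by omega) h1
  have h3 := lt_period (blockParam r) k.natAbs
  omega

theorem recurrence_toeplitz_le {r : ℝ} (hr : 2 ≤ r) : ∃ C : ℝ, 0 < C ∧ ∀ n : ℕ, 2 ≤ n →
    (recurrence (toeplitz (blockParam r)) n : ℝ) ≤ Real.exp (C * Real.log n ^ r) := by
  set M := blockParam r with hM
  have h5 : (0 : ℝ) < 5 ^ r := by positivity
  have hlog2 : 0 < Real.log 2 := Real.log_pos (by norm_num)
  have hl2 : 0 < Real.log 2 ^ r := Real.rpow_pos_of_pos hlog2 r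
  have hP1 : (1 : ℝ) ≤ period M 1 := by exact_mod_cast period_pos M 1
  have hC0 : 0 < Real.log (2 * period M 1) / Real.log 2 ^ r :=
    div_pos (Real.log_pos (by linarith)) hl2
  refine ⟨(12 + 6 * 5 ^ r) + Real.log (2 * period M 1) / Real.log 2 ^ r, by positivity,
    fun n hn => ?_⟩
  have hlogn : Real.log 2 ≤ Real.log n :=
    Real.log_le_log (by norm_num) (by exact_mod_cast hn)
  have hlognr : 0 < Real.log n ^ r := Real.rpow_pos_of_pos (by linarith) r
  -- the first level at which all words of length `n` recur within one block
  have hex : ∃ i, n + period M i ≤ M i * period M i + 1 := by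
    refine ⟨n, ?_⟩
    have h1 : 2 ≤ M n := two_le_blockParam hr n
    have h2 := lt_period M n
    nlinarith
  classical
  have hi := Nat.find_spec hex
  have hmin : ∀ j < Nat.find hex, ¬ (n + period M j ≤ M j * period M j + 1) :=
    fun j hj => Nat.find_min hex hj
  generalize Nat.find hex = i at hi hmin
  have hR : recurrence (toeplitz M) n ≤ 2 * period M (i + 1) :=
    Nat.sInf_le (recursWithin_toeplitz M i hi)
  have hR' : (recurrence (toeplitz M) n : ℝ) ≤ 2 * period M (i + 1) := by exact_mod_cast hR
  refine hR'.trans ?_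
  rcases i with _ | j
  · rw [zero_add, ← Real.log_le_iff_le_exp (by positivity)]
    have h : Real.log (2 * period M 1) ≤ Real.log (2 * period M 1) / Real.log 2 ^ r
        * Real.log n ^ r := by
      rw [div_mul_eq_mul_div, le_div_iff₀ hl2]
      exact mul_le_mul_of_nonneg_left (Real.rpow_le_rpow hlog2.le hlogn (by linarith))
        (Real.log_nonneg (by linarith))
    nlinarith
  · have hj := hmin j (by omega)
    have h1 : 2 ≤ M j := two_le_blockParam hr j
    have hPn : period M j ≤ n := by nlinarith
    have hP : (0 : ℝ) < period M j := by exact_mod_cast period_pos M j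
    have hlog : Real.log (period M j) ≤ Real.log n :=
      Real.log_le_log hP (by exact_mod_cast hPn)
    refine (two_mul_period_le_exp hr j).trans (Real.exp_le_exp.2 ?_)
    have h2 : Real.log (period M j) ^ r ≤ Real.log n ^ r :=
      Real.rpow_le_rpow (by linarith [one_le_log_period M j]) hlog (by linarith)
    exact mul_le_mul (by linarith) h2 (by linarith [one_le_log_period_rpow hr M j]) (by positivity)

theorem complexity_toeplitz_ge {r : ℝ} (hr : 2 ≤ r) : ∃ (c : ℝ) (m : ℕ → ℕ), 0 < c ∧ StrictMono m ∧ ∀ i : ℕ, 1 ≤ m i ∧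
    Real.exp (c * Real.log (m i) ^ r) ≤ (complexity (toeplitz (blockParam r)) (m i) : ℝ) := by
  set M := blockParam r with hM
  have hlog2 : 0 < Real.log 2 := Real.log_pos (by norm_num)
  have hr3 : 0 < (r + 3) ^ r := Real.rpow_pos_of_pos (by linarith) r
  refine ⟨Real.log 2 / (r + 3) ^ r, fun s => M (2 * s + 1) * period M (2 * s + 1), by positivity,
    strictMono_nat_of_lt_succ fun s => ?_, fun s => ⟨?_, ?_⟩⟩
  · have h1 : M (2 * s + 1) * period M (2 * s + 1) ≤ period M (2 * s + 1 + 1) := by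
      rw [period, mul_comm]
      refine Nat.mul_le_mul_left _ ?_
      unfold blockLength
      have : 1 ≤ 2 ^ M (2 * s + 1) := Nat.one_le_two_pow
      nlinarith
    have h2 := period_strictMono M (show 2 * s + 1 + 1 < 2 * (s + 1) + 1 by omega)
    have h3 : 2 ≤ M (2 * (s + 1) + 1) := two_le_blockParam hr _
    nlinarith
  · exact Nat.mul_pos (by have : 2 ≤ M (2 * s + 1) := two_le_blockParam hr (2 * s + 1); omega) (period_pos _ _)
  · set i := 2 * s + 1 with hi
    have hMi : Real.log (period M i) ^ r ≤ M i := by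
      have h := blockParam_of_odd r (i := i) (by grind)
      rw [hM, h]
      push_cast
      linarith [Nat.le_ceil (Real.log (period (blockParam r) i) ^ r)]
    have h0 := one_le_log_period M i
    have hM0 : (0 : ℝ) < M i := by
      have : 2 ≤ M i := two_le_blockParam hr i
      exact_mod_cast (by omega : 0 < M i)
    have hP : (0 : ℝ) < period M i := by exact_mod_cast period_pos M i
    have hlogM : Real.log (M i) ≤ (r + 2) * Real.log (period M i) := by
      have h1 := Real.log_le_log hM0 (blockParam_le hr i)
      rw [Real.log_mul (by norm_num) (by linarith [one_le_log_period_rpow hr M i]),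
        Real.log_rpow (by linarith)] at h1
      have h2 : Real.log 3 ≤ 2 := by
        have := Real.log_le_sub_one_of_pos (show (0 : ℝ) < 3 by norm_num); linarith
      have h3 : Real.log (Real.log (period M i)) ≤ Real.log (period M i) := by
        have := Real.log_le_sub_one_of_pos (show 0 < Real.log (period M i) by linarith); linarith
      nlinarith
    have hlogm : Real.log ((M i * period M i : ℕ) : ℝ) ≤ (r + 3) * Real.log (period M i) := by
      rw [Nat.cast_mul, Real.log_mul hM0.ne' hP.ne']
      linarith
    have hpow : Real.log ((M i * period M i : ℕ) : ℝ) ^ r ≤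
        (r + 3) ^ r * Real.log (period M i) ^ r := by
      rw [← Real.mul_rpow (by linarith) (by linarith)]
      exact Real.rpow_le_rpow (Real.log_natCast_nonneg _) hlogm (by linarith)
    have hc : (2 : ℝ) ^ M i ≤ (complexity (toeplitz M) (M i * period M i) : ℝ) := by
      exact_mod_cast two_pow_le_complexity_toeplitz M i
    refine le_trans ?_ hc
    rw [← Real.rpow_natCast, Real.rpow_def_of_pos (by norm_num : (0 : ℝ) < 2)]
    refine Real.exp_le_exp.2 ?_
    calc Real.log 2 / (r + 3) ^ r * Real.log ((M i * period M i : ℕ) : ℝ) ^ r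
        ≤ Real.log 2 / (r + 3) ^ r * ((r + 3) ^ r * Real.log (period M i) ^ r) :=
          mul_le_mul_of_nonneg_left hpow (by positivity)
      _ = Real.log 2 * Real.log (period M i) ^ r := by field_simp
      _ ≤ Real.log 2 * M i := mul_le_mul_of_nonneg_left hMi hlog2.le

/-! ### Local permutations of the integers -/

theorem perm_apply_inv_apply {α : Type*} (g : Equiv.Perm α) (a : α) : g (g⁻¹ a) = a :=
  g.apply_symm_apply a

theorem perm_inv_apply_apply {α : Type*} (g : Equiv.Perm α) (a : α) : g⁻¹ (g a) = a :=
  g.symm_apply_apply a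

/-- The word `x` looks the same in the windows of radius `n` around `k` and around `l`. -/
def WindowEq {A : Type*} (x : ℤ → A) (n : ℕ) (k l : ℤ) : Prop :=
  ∀ i : ℤ, |i| ≤ n → x (k + i) = x (l + i)

theorem WindowEq.symm {A : Type*} {x : ℤ → A} {n : ℕ} {k l : ℤ} (h : WindowEq x n k l) :
    WindowEq x n l k := fun i hi => (h i hi).symm

theorem WindowEq.shift {A : Type*} {x : ℤ → A} {n m p : ℕ} {k l d : ℤ} (h : WindowEq x n k l)
    (hd : |d| ≤ m) (hp : p + m ≤ n) : WindowEq x p (k + d) (l + d) := by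
  intro i hi
  have h1 := h (d + i) (by
    have h2 := abs_add_le d i
    have h3 : ((p + m : ℕ) : ℤ) ≤ n := by exact_mod_cast hp
    push_cast at h3
    linarith)
  rwa [← add_assoc, ← add_assoc] at h1

theorem WindowEq.mono {A : Type*} {x : ℤ → A} {n p : ℕ} {k l : ℤ} (h : WindowEq x n k l)
    (hp : p ≤ n) : WindowEq x p k l :=
  fun i hi => h i (hi.trans (by exact_mod_cast hp))

/-- The permutation `g` moves points by at most `n`, and its displacement at `k` is determined by the
window of `x` of radius `n` around `k`. -/
def LocalWithin {A : Type*} (x : ℤ → A) (n : ℕ) (g : Equiv.Perm ℤ) : Prop :=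
  (∀ k, |g k - k| ≤ n) ∧ ∀ k l, WindowEq x n k l → g k - k = g l - l

theorem LocalWithin.one {A : Type*} (x : ℤ → A) (n : ℕ) : LocalWithin x n 1 :=
  ⟨fun k => by simp, fun k l _ => by simp⟩

theorem LocalWithin.mono {A : Type*} {x : ℤ → A} {n p : ℕ} {g : Equiv.Perm ℤ}
    (h : LocalWithin x n g) (hp : n ≤ p) : LocalWithin x p g :=
  ⟨fun k => (h.1 k).trans (by exact_mod_cast hp), fun k l hkl => h.2 k l (hkl.mono hp)⟩

theorem LocalWithin.mul {A : Type*} {x : ℤ → A} {n m : ℕ} {g h : Equiv.Perm ℤ}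
    (hg : LocalWithin x n g) (hh : LocalWithin x m h) : LocalWithin x (n + m) (g * h) := by
  refine ⟨fun k => ?_, fun k l hkl => ?_⟩
  · have h1 := hg.1 (h k)
    have h2 := hh.1 k
    have h3 := abs_add_le (g (h k) - h k) (h k - k)
    rw [sub_add_sub_cancel] at h3
    push_cast
    exact h3.trans (add_le_add h1 h2)
  · have h1 := hh.2 k l (hkl.mono (by omega))
    have h2 := hg.2 _ _ (hkl.shift (hh.1 k) le_rfl)
    have e1 : k + (h k - k) = h k := by ring
    have e2 : l + (h k - k) = h l := by rw [h1]; ring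
    rw [e1, e2] at h2
    simp only [Equiv.Perm.mul_apply]
    linarith

theorem LocalWithin.inv {A : Type*} {x : ℤ → A} {n : ℕ} {g : Equiv.Perm ℤ}
    (hg : LocalWithin x n g) : LocalWithin x (n + n) g⁻¹ := by
  have h0 : ∀ k, |g⁻¹ k - k| ≤ n := fun k => by
    have := hg.1 (g⁻¹ k)
    rwa [perm_apply_inv_apply, abs_sub_comm] at this
  refine ⟨fun k => (h0 k).trans (by push_cast; linarith [Int.natCast_nonneg n]), fun k l hkl => ?_⟩
  have h1 := hg.2 _ _ (hkl.shift (h0 k) le_rfl)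
  rw [add_sub_cancel, perm_apply_inv_apply] at h1
  have h2 : g (l + (g⁻¹ k - k)) = l := by linarith
  rw [← h2, perm_inv_apply_apply, h2]
  ring

/-- The group of the permutations of `ℤ` whose displacement is determined by a window of `x` of bounded
radius. It is the topological full group of the subshift generated by `x`, acting on the orbit
of `x`. -/
def localGroup {A : Type*} (x : ℤ → A) : Subgroup (Equiv.Perm ℤ) where
  carrier := {g | ∃ n, LocalWithin x n g}
  one_mem' := ⟨0, LocalWithin.one x 0⟩
  mul_mem' := by
    rintro g h ⟨n, hn⟩ ⟨m, hm⟩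
    exact ⟨_, hn.mul hm⟩
  inv_mem' := by
    rintro g ⟨n, hn⟩
    exact ⟨_, hn.inv⟩

/-- A function whose value at `k` is determined by a window of `x` around `k` takes finitely many
values. -/
theorem finite_range_of_windowEq {A β : Type*} [Finite A] {x : ℤ → A} {n : ℕ} {f : ℤ → β}
    (hf : ∀ k l, WindowEq x n k l → f k = f l) : (Set.range f).Finite := by
  have hfac : ∃ F : (Set.Icc (-(n : ℤ)) n → A) → β, ∀ k, f k = F (fun i => x (k + i)) := by
    classical
    refine ⟨fun w => if h : ∃ k, (fun i : Set.Icc (-(n : ℤ)) n => x (k + i)) = w then f h.choose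
      else f 0, fun k => ?_⟩
    have h : ∃ l, (fun i : Set.Icc (-(n : ℤ)) n => x (l + i)) =
        (fun i : Set.Icc (-(n : ℤ)) n => x (k + i)) := ⟨k, rfl⟩
    beta_reduce
    rw [dif_pos h]
    refine hf _ _ fun i hi => ?_
    exact (congrFun h.choose_spec ⟨i, abs_le.1 hi⟩).symm
  obtain ⟨F, hF⟩ := hfac
  refine (Set.finite_range F).subset ?_
  rintro _ ⟨k, rfl⟩
  exact ⟨_, (hF k).symm⟩

/-! ### Three-cycles of local sets -/

/-- The permutation `g` cycles `e 0 v → e 1 v → e 2 v → e 0 v` for all `v ∈ V`, where all these points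
are distinct, and fixes everything else. -/
structure IsCyc (V : Set ℤ) (e : Fin 3 → ℤ → ℤ) (g : Equiv.Perm ℤ) : Prop where
  inj : ∀ v ∈ V, ∀ w ∈ V, ∀ i j, e i v = e j w → i = j ∧ v = w
  map : ∀ v ∈ V, ∀ i, g (e i v) = e (i + 1) v
  fix : ∀ k, (∀ v ∈ V, ∀ i, e i v ≠ k) → g k = k

theorem exists_isCyc {V : Set ℤ} {e : Fin 3 → ℤ → ℤ}
    (h : ∀ v ∈ V, ∀ w ∈ V, ∀ i j, e i v = e j w → i = j ∧ v = w) : ∃ g, IsCyc V e g := by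
  let ι : V × Fin 3 ↪ ℤ := ⟨fun p => e p.2 p.1, fun p q hpq => by
    obtain ⟨h1, h2⟩ := h _ p.1.2 _ q.1.2 _ _ hpq
    exact Prod.ext (Subtype.ext h2) h1⟩
  let c : Equiv.Perm (V × Fin 3) := Equiv.prodCongr (Equiv.refl V) (Equiv.addRight (1 : Fin 3))
  refine ⟨c.viaEmbedding ι, h, fun v hv i => ?_, fun k hk => ?_⟩
  · exact Equiv.Perm.viaEmbedding_apply c ι (⟨v, hv⟩, i)
  · refine Equiv.Perm.viaEmbedding_apply_of_notMem c ι k ?_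
    rintro ⟨⟨v, i⟩, hvi⟩
    exact hk v v.2 i hvi

namespace IsCyc

variable {V W : Set ℤ} {e f : Fin 3 → ℤ → ℤ} {g h : Equiv.Perm ℤ}

theorem eq_of (hg : IsCyc V e g) (hh : IsCyc V e h) : g = h := by
  ext k
  by_cases hk : ∃ v ∈ V, ∃ i, e i v = k
  · obtain ⟨v, hv, i, rfl⟩ := hk
    rw [hg.map v hv, hh.map v hv]
  · push Not at hk
    rw [hg.fix k hk, hh.fix k hk]

theorem congr (hg : IsCyc V e g) (hef : ∀ v ∈ V, ∀ i, e i v = f i v) : IsCyc V f g where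
  inj v hv w hw i j hij := hg.inj v hv w hw i j (by rw [hef v hv, hef w hw, hij])
  map v hv i := by rw [← hef v hv, ← hef v hv, hg.map v hv]
  fix k hk := hg.fix k fun v hv i => by rw [hef v hv]; exact hk v hv i

theorem subset (hg : IsCyc V e g) (hWV : W ⊆ V) : ∃ h, IsCyc W e h :=
  exists_isCyc fun v hv w hw => hg.inj v (hWV hv) w (hWV hw)

theorem rotate (hg : IsCyc V e g) (a : Fin 3) : IsCyc V (fun i => e (i + a)) g where
  inj v hv w hw i j hij := by
    obtain ⟨h1, h2⟩ := hg.inj v hv w hw _ _ hij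
    exact ⟨add_right_cancel h1, h2⟩
  map v hv i := by rw [hg.map v hv, add_right_comm]
  fix k hk := hg.fix k fun v hv i => by
    have := hk v hv (i - a)
    rwa [sub_add_cancel] at this

theorem inv_map (hg : IsCyc V e g) {v : ℤ} (hv : v ∈ V) (i : Fin 3) : g⁻¹ (e (i + 1) v) = e i v := by
  rw [← hg.map v hv, perm_inv_apply_apply]

theorem inv_fix (hg : IsCyc V e g) {k : ℤ} (hk : ∀ v ∈ V, ∀ i, e i v ≠ k) : g⁻¹ k = k := by
  rw [Equiv.Perm.inv_eq_iff_eq, hg.fix k hk]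

theorem inv (hg : IsCyc V e g) : IsCyc V (fun i => e (-i)) g⁻¹ where
  inj v hv w hw i j hij := by
    obtain ⟨h1, h2⟩ := hg.inj v hv w hw _ _ hij
    exact ⟨neg_injective h1, h2⟩
  map v hv i := by
    have := hg.inv_map hv (-(i + 1))
    rwa [show -(i + 1) + 1 = -i by abel] at this
  fix k hk := hg.inv_fix fun v hv i => by
    have := hk v hv (-i)
    rwa [neg_neg] at this

theorem conj (hg : IsCyc V e g) (s : Equiv.Perm ℤ) :
    IsCyc V (fun i v => s (e i v)) (s * g * s⁻¹) where
  inj v hv w hw i j hij := hg.inj v hv w hw i j (s.injective hij)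
  map v hv i := by
    simp only [Equiv.Perm.mul_apply, perm_inv_apply_apply, hg.map v hv]
  fix k hk := by
    have h := hg.fix (s⁻¹ k) fun v hv i h => hk v hv i (by rw [h, perm_apply_inv_apply])
    simp only [Equiv.Perm.mul_apply, h, perm_apply_inv_apply]

/-- Reparametrization of the set of a three-cycle by a translation. -/
theorem translate (hg : IsCyc V e g) (d : ℤ) :
    IsCyc {l | l + d ∈ V} (fun i l => e i (l + d)) g where
  inj v hv w hw i j hij := by
    obtain ⟨h1, h2⟩ := hg.inj _ hv _ hw _ _ hij
    exact ⟨h1, add_right_cancel h2⟩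
  map v hv i := hg.map _ hv i
  fix k hk := hg.fix k fun v hv i => by
    have := hk (v - d) (by simpa using hv) i
    rwa [sub_add_cancel] at this

/-- A three-cycle splits along a partition of its set. -/
theorem eq_mul_of_union {g₁ g₂ : Equiv.Perm ℤ} (hg : IsCyc (V ∪ W) e g) (hVW : Disjoint V W)
    (h₁ : IsCyc V e g₁) (h₂ : IsCyc W e g₂) : g = g₁ * g₂ := by
  have key : ∀ v ∈ V, ∀ w ∈ W, ∀ i j, e i v ≠ e j w := fun v hv w hw i j hij => by
    obtain ⟨-, rfl⟩ := hg.inj v (Or.inl hv) w (Or.inr hw) i j hij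
    exact Set.disjoint_left.1 hVW hv hw
  ext k
  rw [Equiv.Perm.mul_apply]
  by_cases hV : ∃ v ∈ V, ∃ i, e i v = k
  · obtain ⟨v, hv, i, rfl⟩ := hV
    rw [h₂.fix _ fun w hw j => (key v hv w hw i j).symm, h₁.map v hv, hg.map v (Or.inl hv)]
  push Not at hV
  by_cases hW : ∃ w ∈ W, ∃ i, e i w = k
  · obtain ⟨w, hw, i, rfl⟩ := hW
    rw [h₂.map w hw, h₁.fix _ fun v hv j => key v hv w hw j _, hg.map w (Or.inr hw)]
  push Not at hW
  rw [h₂.fix k hW, h₁.fix k hV, hg.fix k]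
  rintro v (hv | hv)
  · exact hV v hv
  · exact hW v hv

/-- If two three-cycles, over `V` and over `W`, meet exactly in the points `e 2 v = f 0 v` with
`v ∈ V ∩ W`, then their commutator is a three-cycle over `V ∩ W`. -/
theorem commutator (hg : IsCyc V e g) (hh : IsCyc W f h)
    (hmeet : ∀ v ∈ V ∩ W, e 2 v = f 0 v)
    (honly : ∀ v ∈ V, ∀ w ∈ W, ∀ i j, e i v = f j w → v = w ∧ i = 2 ∧ j = 0) :
    IsCyc (V ∩ W) (fun i v => ![e 1 v, f 0 v, f 1 v] i) (h * g⁻¹ * h⁻¹ * g) := by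
  have hgm := fun v hv => hg.map v hv
  have hhm := fun v hv => hh.map v hv
  have hgi : ∀ v ∈ V, ∀ i, g⁻¹ (e (i + 1) v) = e i v := fun v hv i => hg.inv_map hv i
  have hhi : ∀ v ∈ W, ∀ i, h⁻¹ (f (i + 1) v) = f i v := fun v hv i => hh.inv_map hv i
  have hef : ∀ v ∈ V, ∀ i, i ≠ 2 → h (e i v) = e i v ∧ h⁻¹ (e i v) = e i v := fun v hv i hi => by
    have : ∀ w ∈ W, ∀ j, f j w ≠ e i v := fun w hw j hj => hi (honly v hv w hw i j hj.symm).2.1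
    exact ⟨hh.fix _ this, hh.inv_fix this⟩
  have hfe : ∀ v ∈ W, ∀ i, i ≠ 0 → g (f i v) = f i v ∧ g⁻¹ (f i v) = f i v := fun v hv i hi => by
    have : ∀ w ∈ V, ∀ j, e j w ≠ f i v := fun w hw j hj => hi (honly w hw v hv j i hj).2.2
    exact ⟨hg.fix _ this, hg.inv_fix this⟩
  have hVW : ∀ v ∈ V, v ∉ W → h (e 2 v) = e 2 v ∧ h⁻¹ (e 2 v) = e 2 v := fun v hv hvW => by
    have : ∀ w ∈ W, ∀ j, f j w ≠ e 2 v := fun w hw j hj =>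
      hvW ((honly v hv w hw 2 j hj.symm).1 ▸ hw)
    exact ⟨hh.fix _ this, hh.inv_fix this⟩
  have hWV : ∀ v ∈ W, v ∉ V → g (f 0 v) = f 0 v ∧ g⁻¹ (f 0 v) = f 0 v := fun v hv hvV => by
    have : ∀ w ∈ V, ∀ j, e j w ≠ f 0 v := fun w hw j hj =>
      hvV ((honly w hw v hv j 0 hj).1 ▸ hw)
    exact ⟨hg.fix _ this, hg.inv_fix this⟩
  have i01 : (0 : Fin 3) ≠ 2 := by decide
  have i12 : (1 : Fin 3) ≠ 2 := by decide
  have i10 : (1 : Fin 3) ≠ 0 := by decide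
  have i20 : (2 : Fin 3) ≠ 0 := by decide
  have g0 := fun v hv => hgm v hv 0
  have g1 := fun v hv => hgm v hv 1
  have g2 := fun v hv => hgm v hv 2
  have h0 := fun v hv => hhm v hv 0
  have h1 := fun v hv => hhm v hv 1
  have h2 := fun v hv => hhm v hv 2
  have gi0 := fun v hv => hgi v hv 0
  have gi1 := fun v hv => hgi v hv 1
  have gi2 := fun v hv => hgi v hv 2
  have hi0 := fun v hv => hhi v hv 0
  have hi1 := fun v hv => hhi v hv 1
  have hi2 := fun v hv => hhi v hv 2
  rw [show (0 : Fin 3) + 1 = 1 from rfl] at g0 h0 gi0 hi0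
  rw [show (1 : Fin 3) + 1 = 2 from rfl] at g1 h1 gi1 hi1
  rw [show (2 : Fin 3) + 1 = 0 from rfl] at g2 h2 gi2 hi2
  refine ⟨?_, ?_, ?_⟩
  · rintro v ⟨hvV, hvW⟩ w ⟨hwV, hwW⟩ i j hij
    have a1 := fun j => honly v hvV w hwW 1 j
    have a2 := fun j => honly w hwV v hvW 1 j
    have a3 := hg.inj v hvV w hwV 1 1
    have a4 := hh.inj v hvW w hwW
    fin_cases i <;> fin_cases j <;> simp at hij ⊢ <;> grind
  · rintro v ⟨hvV, hvW⟩ i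
    have hm := hmeet v ⟨hvV, hvW⟩
    fin_cases i
    · change h (g⁻¹ (h⁻¹ (g (e 1 v)))) = f 0 v
      rw [g1 v hvV, hm, hi2 v hvW, (hfe v hvW 2 i20).2, h2 v hvW]
    · change h (g⁻¹ (h⁻¹ (g (f 0 v)))) = f 1 v
      rw [← hm, g2 v hvV, (hef v hvV 0 i01).2, gi2 v hvV, hm, h0 v hvW]
    · change h (g⁻¹ (h⁻¹ (g (f 1 v)))) = e 1 v
      rw [(hfe v hvW 1 i10).1, hi0 v hvW, ← hm, gi1 v hvV, (hef v hvV 1 i12).1]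
  · intro k hk
    change h (g⁻¹ (h⁻¹ (g k))) = k
    by_cases hV : ∃ v ∈ V, ∃ i, e i v = k
    · obtain ⟨v, hv, i, rfl⟩ := hV
      by_cases hvW : v ∈ W
      · have hm := hmeet v ⟨hv, hvW⟩
        have k1 := hk v ⟨hv, hvW⟩ 0
        have k2 := hk v ⟨hv, hvW⟩ 1
        have i0 : i = 0 := by
          fin_cases i
          · rfl
          · exact absurd rfl k1
          · exact absurd hm.symm k2
        subst i0
        rw [g0 v hv, (hef v hv 1 i12).2, gi0 v hv, (hef v hv 0 i01).1]
      · have hall : ∀ i, h (e i v) = e i v ∧ h⁻¹ (e i v) = e i v := fun i => by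
          by_cases hi : i = 2
          · subst hi; exact hVW v hv hvW
          · exact hef v hv i hi
        rw [hgm v hv, (hall _).2, hgi v hv, (hall _).1]
    push Not at hV
    have hgk : g k = k := hg.fix k hV
    have hgk' : g⁻¹ k = k := hg.inv_fix hV
    by_cases hW : ∃ v ∈ W, ∃ i, f i v = k
    · obtain ⟨v, hv, i, rfl⟩ := hW
      rw [hgk]
      by_cases hvV : v ∈ V
      · have hm := hmeet v ⟨hvV, hv⟩
        have k2 := hk v ⟨hvV, hv⟩ 1
        have k3 := hk v ⟨hvV, hv⟩ 2
        have i2 : i = 2 := by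
          fin_cases i
          · exact absurd rfl k2
          · exact absurd rfl k3
          · rfl
        subst i2
        rw [hi1 v hv, (hfe v hv 1 i10).2, h1 v hv]
      · have hall : ∀ i, g⁻¹ (f i v) = f i v := fun i => by
          by_cases hi : i = 0
          · subst hi; exact (hWV v hv hvV).2
          · exact (hfe v hv i hi).2
        have hi : i = i - 1 + 1 := by rw [sub_add_cancel]
        rw [hi, hhi v hv, hall, hhm v hv]
    push Not at hW
    have hhk : h k = k := hh.fix k hW
    rw [hgk, hh.inv_fix hW, hgk', hhk]

end IsCyc

/-! ### Commutators of local permutations are products of three-cycles -/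

/-- The set `V` and the displacements of the three points `e i v` are determined by windows of `x` of
radius `n`, and the displacements are at most `n`. -/
structure LocalData {A : Type*} (x : ℤ → A) (n : ℕ) (V : Set ℤ) (e : Fin 3 → ℤ → ℤ) : Prop where
  mem : ∀ k l, WindowEq x n k l → k ∈ V → l ∈ V
  bound : ∀ v ∈ V, ∀ i, |e i v - v| ≤ n
  disp : ∀ k l, WindowEq x n k l → k ∈ V → ∀ i, e i k - k = e i l - l

/-- The subgroup generated by all local three-cycles. -/
def threeCycleGroup {A : Type*} (x : ℤ → A) : Subgroup (Equiv.Perm ℤ) :=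
  Subgroup.closure {g | ∃ n V e, LocalData x n V e ∧ IsCyc V e g}

theorem IsCyc.localWithin {A : Type*} {x : ℤ → A} {n : ℕ} {V : Set ℤ} {e : Fin 3 → ℤ → ℤ}
    {g : Equiv.Perm ℤ} (hg : IsCyc V e g) (hV : LocalData x n V e) :
    LocalWithin x (n + n) g := by
  have key : ∀ k l, WindowEq x (n + n) k l → ∀ v ∈ V, ∀ i, e i v = k →
      ∃ w ∈ V, e i w = l ∧ e (i + 1) w - l = e (i + 1) v - k := by
    rintro k l hkl v hv i rfl
    have hb := hV.bound v hv i
    have hw := hkl.shift (d := -(e i v - v)) (p := n) (m := n) (by rwa [abs_neg]) le_rfl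
    rw [show e i v + -(e i v - v) = v by ring] at hw
    have h1 := hV.disp _ _ hw hv i
    have h2 := hV.disp _ _ hw hv (i + 1)
    exact ⟨_, hV.mem _ _ hw hv, by linarith, by linarith⟩
  refine ⟨fun k => ?_, fun k l hkl => ?_⟩
  · by_cases hk : ∃ v ∈ V, ∃ i, e i v = k
    · obtain ⟨v, hv, i, rfl⟩ := hk
      rw [hg.map v hv]
      have h1 := hV.bound v hv i
      have h2 := hV.bound v hv (i + 1)
      rw [abs_le] at *
      push_cast
      constructor <;> linarith
    · push Not at hk
      rw [hg.fix k hk, sub_self, abs_zero]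
      positivity
  · by_cases hk : ∃ v ∈ V, ∃ i, e i v = k
    · obtain ⟨v, hv, i, hvk⟩ := hk
      obtain ⟨w, hw, hwl, hd⟩ := key k l hkl v hv i hvk
      rw [← hvk, hg.map v hv, hvk, ← hd, ← hwl, hg.map w hw]
    · have hl : ¬ ∃ v ∈ V, ∃ i, e i v = l := by
        rintro ⟨v, hv, i, hvl⟩
        obtain ⟨w, hw, hwk, -⟩ := key l k hkl.symm v hv i hvl
        exact hk ⟨w, hw, i, hwk⟩
      push Not at hk hl
      rw [hg.fix k hk, hg.fix l hl, sub_self, sub_self]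

theorem threeCycleGroup_le_localGroup {A : Type*} (x : ℤ → A) :
    threeCycleGroup x ≤ localGroup x := by
  rw [threeCycleGroup, Subgroup.closure_le]
  rintro g ⟨n, V, e, hV, hg⟩
  exact ⟨_, hg.localWithin hV⟩

theorem LocalData.conj {A : Type*} {x : ℤ → A} {n m : ℕ} {V : Set ℤ} {e : Fin 3 → ℤ → ℤ}
    {s : Equiv.Perm ℤ} (hV : LocalData x n V e) (hs : LocalWithin x m s) :
    LocalData x (n + m) V (fun i v => s (e i v)) where
  mem k l hkl hk := hV.mem k l (hkl.mono (by omega)) hk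
  bound v hv i := by
    have h1 := hV.bound v hv i
    have h2 := hs.1 (e i v)
    rw [abs_le] at *
    push_cast
    constructor <;> linarith
  disp k l hkl hk i := by
    have h1 := hV.disp k l (hkl.mono (by omega)) hk i
    have h2 := hs.2 _ _ (hkl.shift (hV.bound k hk i) (by omega))
    rw [show k + (e i k - k) = e i k by ring, show l + (e i k - k) = e i l by linarith] at h2
    linarith

theorem conj_mem_threeCycleGroup {A : Type*} {x : ℤ → A} {s g : Equiv.Perm ℤ}
    (hs : s ∈ localGroup x) (hg : g ∈ threeCycleGroup x) : s * g * s⁻¹ ∈ threeCycleGroup x := by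
  obtain ⟨m, hm⟩ := hs
  induction hg using Subgroup.closure_induction with
  | mem g hg =>
    obtain ⟨n, V, e, hV, hg⟩ := hg
    exact Subgroup.subset_closure ⟨_, V, _, hV.conj hm, hg.conj s⟩
  | one => simp
  | mul g h _ _ h1 h2 =>
    have : s * (g * h) * s⁻¹ = (s * g * s⁻¹) * (s * h * s⁻¹) := by group
    rw [this]; exact mul_mem h1 h2
  | inv g _ h1 =>
    have : s * g⁻¹ * s⁻¹ = (s * g * s⁻¹)⁻¹ := by group
    rw [this]; exact inv_mem h1

/-- If `g` and `h` agree modulo a normal subgroup `N` of `M` with elements a conjugate of which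
commute, then the commutator of `g` and `h` lies in `N`. -/
theorem commutatorElement_mem_of_commute {G : Type*} [Group G] {M N : Subgroup G} (hNM : N ≤ M)
    (hnorm : ∀ s ∈ M, ∀ g ∈ N, s * g * s⁻¹ ∈ N) {g h s t n : G} (hg : g ∈ M) (hh : h ∈ M)
    (hs : s ∈ N) (ht : t ∈ N) (hn : n ∈ N) (hc : Commute (n * (s * g) * n⁻¹) (t * h)) :
    g * h * g⁻¹ * h⁻¹ ∈ N := by
  have : (N.subgroupOf M).Normal := ⟨fun a ha b => hnorm b b.2 a ha⟩
  let π : M →* M ⧸ N.subgroupOf M := QuotientGroup.mk' _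
  have hπ : ∀ a : M, (a : G) ∈ N → π a = 1 := fun a ha => (QuotientGroup.eq_one_iff a).2 ha
  let g' : M := ⟨g, hg⟩
  let h' : M := ⟨h, hh⟩
  let s' : M := ⟨s, hNM hs⟩
  let t' : M := ⟨t, hNM ht⟩
  let n' : M := ⟨n, hNM hn⟩
  have hc' : (n' * (s' * g') * n'⁻¹) * (t' * h') = (t' * h') * (n' * (s' * g') * n'⁻¹) :=
    Subtype.ext hc
  have h1 := congrArg π hc'
  simp only [map_mul, map_inv, hπ s' hs, hπ t' ht, hπ n' hn, one_mul, inv_one, mul_one] at h1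
  have h2 : π (g' * h' * g'⁻¹ * h'⁻¹) = 1 := by
    simp only [map_mul, map_inv, h1, mul_inv_cancel_right, mul_inv_cancel]
  exact (QuotientGroup.eq_one_iff (N := N.subgroupOf M) (g' * h' * g'⁻¹ * h'⁻¹)).1 h2

/-- Windows of `x` determine positions modulo arbitrarily large numbers. -/
def HasPeriods {A : Type*} (x : ℤ → A) : Prop :=
  ∀ L : ℕ, ∃ P n : ℕ, L < P ∧ ∀ k l, WindowEq x n k l → (P : ℤ) ∣ k - l

/-- Cut `ℤ` into intervals of length `P`. A local permutation `g` that moves points by at most `D` can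
be multiplied by local three-cycles so that all points far from the ends of the intervals become fixed:
these points are corrected one level after the other, by three-cycles that use one of two
spare levels. -/
theorem exists_threeCycle_mul_fix {A : Type*} {x : ℤ → A} {g : Equiv.Perm ℤ} {D P n₀ : ℕ}
    (hg : LocalWithin x D g) (hP : 2 * D + 2 < P)
    (hper : ∀ k l, WindowEq x n₀ k l → (P : ℤ) ∣ k - l) (j : ℕ) (hj : D + 2 ≤ j)
    (hjP : j + D ≤ P) :
    ∃ t ∈ threeCycleGroup x,
      (∀ v : ℤ, (P : ℤ) ∣ v → ∀ i : ℕ, D + 2 ≤ i → i < j → t (g (v + i)) = v + i) ∧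
      (∀ v : ℤ, (P : ℤ) ∣ v → ∀ i : ℕ, D + 2 ≤ i → i + D < P →
        v ≤ t (g (v + i)) ∧ t (g (v + i)) < v + P) := by
  induction j, hj using Nat.le_induction with
  | base =>
    refine ⟨1, Subgroup.one_mem _, fun v _ i h1 h2 => by omega, fun v _ i h1 h2 => ?_⟩
    have := abs_le.1 (hg.1 (v + i))
    simp only [Equiv.Perm.one_apply]
    omega
  | succ j hj ih =>
    obtain ⟨t, ht, hfix, hint⟩ := ih (by omega)
    have htl : t * g ∈ localGroup x :=
      mul_mem (threeCycleGroup_le_localGroup x ht) ⟨D, hg⟩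
    obtain ⟨m, hm⟩ := htl
    let V : Set ℤ := {v | (P : ℤ) ∣ v ∧ t (g (v + j)) ≠ v + j}
    let r : ℤ → ℤ := fun v => if t (g (v + j)) = v + D then v + D + 1 else v + D
    let e : Fin 3 → ℤ → ℤ := fun i v => ![t (g (v + j)), v + j, r v] i
    have hint' : ∀ v ∈ V, ∀ i, v ≤ e i v ∧ e i v < v + P := by
      rintro v ⟨hv, -⟩ i
      have h1 := hint v hv j hj (by omega)
      fin_cases i
      · exact h1
      · change v ≤ v + j ∧ v + j < v + P; omega
      · change v ≤ r v ∧ r v < v + P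
        simp only [r]; split_ifs <;> omega
    -- the intervals starting at different multiples of `P` are disjoint
    have hsep : ∀ v w y : ℤ, (P : ℤ) ∣ v → (P : ℤ) ∣ w → v ≤ y → y < v + P → w ≤ y → y < w + P →
        v = w := by
      intro v w y hv hw h1 h2 h3 h4
      have := Int.eq_zero_of_abs_lt_dvd (dvd_sub hv hw) (by rw [abs_lt]; constructor <;> omega)
      omega
    have hinj : ∀ v ∈ V, ∀ w ∈ V, ∀ i i', e i v = e i' w → i = i' ∧ v = w := by
      intro v hv w hw i i' h
      obtain ⟨h1, h2⟩ := hint' v hv i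
      obtain ⟨h3, h4⟩ := hint' w hw i'
      obtain rfl := hsep v w _ hv.1 hw.1 h1 h2 (h ▸ h3) (h ▸ h4)
      refine ⟨?_, rfl⟩
      have hne := hv.2
      have hr0 : r v ≠ t (g (v + j)) := by simp only [r]; split_ifs <;> omega
      have hr1 : r v ≠ v + j := by simp only [r]; split_ifs <;> omega
      fin_cases i <;> fin_cases i' <;> simp [e] at h ⊢ <;> grind
    obtain ⟨s, hs⟩ := exists_isCyc hinj
    have hdata : LocalData x (n₀ + m + P) V e := by
      have hkey : ∀ k l, WindowEq x (n₀ + m + P) k l →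
          t (g (k + j)) - k = t (g (l + j)) - l := fun k l hkl => by
        have := hm.2 _ _ (hkl.shift (d := j) (p := m) (m := P) (by rw [Nat.abs_cast]; omega)
          (by omega))
        simp only [Equiv.Perm.mul_apply] at this
        linarith
      refine ⟨?_, ?_, ?_⟩
      · rintro k l hkl ⟨hk, hkj⟩
        have h1 := hkey k l hkl
        refine ⟨?_, fun h => hkj (by linarith)⟩
        have h2 := hper k l (hkl.mono (by omega))
        have := dvd_sub hk h2
        rwa [sub_sub_cancel] at this
      · intro v hv i
        obtain ⟨h1, h2⟩ := hint' v hv i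
        rw [abs_le]
        push_cast
        constructor <;> omega
      · rintro k l hkl - i
        have h1 := hkey k l hkl
        fin_cases i
        · exact h1
        · change k + j - k = l + j - l; ring
        · change r k - k = r l - l
          simp only [r]
          split_ifs <;> omega
    refine ⟨s * t, mul_mem (Subgroup.subset_closure ⟨_, _, _, hdata, hs⟩) ht, ?_, ?_⟩
    · intro v hv i hi hij
      rw [Equiv.Perm.mul_apply]
      rcases Nat.lt_succ_iff_lt_or_eq.1 hij with hij | rfl
      · rw [hfix v hv i hi hij]
        refine hs.fix _ fun w hw i' h => ?_
        obtain ⟨h1, h2⟩ := hint' w hw i'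
        obtain rfl := hsep v w _ hv hw.1 (by omega) (by omega) (h ▸ h1) (h ▸ h2)
        fin_cases i'
        · change t (g (v + j)) = v + i at h
          rw [← hfix v hv i hi hij] at h
          have := g.injective (t.injective h)
          omega
        · change v + (j : ℤ) = v + i at h
          omega
        · change r v = v + i at h
          simp only [r] at h
          split_ifs at h <;> omega
      · by_cases hvV : v ∈ V
        · exact hs.map v hvV 0
        · have h0 : t (g (v + i)) = v + i := by
            by_contra h
            exact hvV ⟨hv, h⟩
          rw [h0]
          refine hs.fix _ fun w hw i' h => ?_
          obtain ⟨h1, h2⟩ := hint' w hw i'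
          obtain rfl := hsep v w _ hv hw.1 (by omega) (by omega) (h ▸ h1) (h ▸ h2)
          exact hvV hw
    · intro v hv i hi hiP
      rw [Equiv.Perm.mul_apply]
      obtain ⟨h1, h2⟩ := hint v hv i hi hiP
      by_cases hk : ∃ w ∈ V, ∃ i', e i' w = t (g (v + i))
      · obtain ⟨w, hw, i', h⟩ := hk
        obtain ⟨h3, h4⟩ := hint' w hw i'
        obtain rfl := hsep v w _ hv hw.1 h1 h2 (h ▸ h3) (h ▸ h4)
        rw [← h, hs.map v hw]
        exact hint' v hw _
      · push Not at hk
        rw [hs.fix _ hk]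
        exact ⟨h1, h2⟩

theorem commutator_localGroup_le {A : Type*} {x : ℤ → A} (hx : HasPeriods x) :
    ⁅localGroup x, localGroup x⁆ ≤ threeCycleGroup x := by
  rw [Subgroup.commutator_le]
  rintro g ⟨D₁, hg⟩ h ⟨D₂, hh⟩
  obtain ⟨D, hD₁, hD₂⟩ : ∃ D, D₁ ≤ D ∧ D₂ ≤ D := ⟨_, le_max_left _ _, le_max_right _ _⟩
  obtain ⟨P, n₀, hP, hper⟩ := hx (6 * D + 6)
  -- `g` and `h` are congruent to permutations supported near the multiples of `P`
  let E : Set ℤ := {k | ∃ v : ℤ, (P : ℤ) ∣ v ∧ v - D ≤ k ∧ k < v + D + 2}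
  have hsupp : ∀ f, LocalWithin x D f → ∃ t ∈ threeCycleGroup x, ∀ k, k ∉ E → (t * f) k = k := by
    intro f hf
    obtain ⟨t, ht, hfix, -⟩ := exists_threeCycle_mul_fix hf (by omega) hper (P - D) (by omega)
      (by omega)
    refine ⟨t, ht, fun k hk => ?_⟩
    have hP0 : (0 : ℤ) < P := by omega
    have hr0 := Int.emod_nonneg k hP0.ne'
    have hr1 := Int.emod_lt_of_pos k hP0
    have hdm := Int.mul_ediv_add_emod k P
    lift k % P to ℕ using hr0 with i hi
    have h1 : D + 2 ≤ i := by
      by_contra h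
      exact hk ⟨P * (k / P), dvd_mul_right _ _, by omega, by omega⟩
    have h2 : i < P - D := by
      by_contra h
      refine hk ⟨P * (k / P) + P, dvd_add (dvd_mul_right _ _) dvd_rfl, by omega, by omega⟩
    have := hfix (P * (k / P)) (dvd_mul_right _ _) i h1 h2
    rwa [hdm] at this
  obtain ⟨s, hs, hsE⟩ := hsupp g (hg.mono hD₁)
  obtain ⟨t, ht, htE⟩ := hsupp h (hh.mono hD₂)
  -- a three-cycle that moves `E` off itself
  let e : Fin 3 → ℤ → ℤ := fun i v => v + (![0, 2 * (D : ℤ) + 2, 4 * D + 4] : Fin 3 → ℤ) i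
  have hinj : ∀ v ∈ E, ∀ w ∈ E, ∀ i j, e i v = e j w → i = j ∧ v = w := by
    rintro v ⟨a, ha, ha1, ha2⟩ w ⟨b, hb, hb1, hb2⟩ i j hij
    have hb0 : ∀ i : Fin 3, (0 : ℤ) ≤ ![(0 : ℤ), 2 * D + 2, 4 * D + 4] i ∧
        ![(0 : ℤ), 2 * D + 2, 4 * D + 4] i ≤ 4 * D + 4 := fun i => by
      fin_cases i <;> simp <;> omega
    have hi := hb0 i
    have hj := hb0 j
    simp only [e] at hij
    have := Int.eq_zero_of_abs_lt_dvd (dvd_sub ha hb) (by rw [abs_lt]; constructor <;> omega)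
    have hab : a = b := by omega
    subst hab
    fin_cases i <;> fin_cases j <;> simp at hij ⊢ <;> omega
  obtain ⟨n, hn⟩ := exists_isCyc hinj
  have hdata : LocalData x (n₀ + (4 * D + 4)) E e := by
    refine ⟨?_, ?_, ?_⟩
    · rintro k l hkl ⟨v, hv, h1, h2⟩
      refine ⟨v - (k - l), dvd_sub hv (hper k l (hkl.mono (by omega))), by omega, by omega⟩
    · intro v _ i
      simp only [e, add_sub_cancel_left]
      fin_cases i <;> simp [abs_le] <;> omega
    · intro k l _ _ i
      simp [e]
  refine commutatorElement_mem_of_commute (threeCycleGroup_le_localGroup x)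
    (fun s hs g hg => conj_mem_threeCycleGroup hs hg) ⟨_, hg⟩ ⟨_, hh⟩ hs ht
    (Subgroup.subset_closure ⟨_, _, _, hdata, hn⟩) (Equiv.Perm.Disjoint.commute fun k => ?_)
  by_cases hk : k ∈ E
  · left
    have h1 : n⁻¹ k = e 2 k := by
      have := hn.inv_map hk 2
      simpa [e] using this
    have h2 : e 2 k ∉ E := fun h => by
      have := (hinj k hk _ h 2 0 (by simp [e])).1
      exact absurd this (by decide)
    rw [Equiv.Perm.mul_apply, Equiv.Perm.mul_apply, h1, hsE _ h2, ← h1, perm_apply_inv_apply]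
  · exact Or.inr (htE k hk)

/-! ### Word balls -/

section WordBall

variable {G : Type*} [Group G] {S : Set G}

theorem wordBall_mono {n m : ℕ} (h : n ≤ m) : wordBall S n ⊆ wordBall S m := by
  rintro g ⟨l, hl, hS, rfl⟩
  exact ⟨l, hl.trans h, hS, rfl⟩

theorem one_mem_wordBall (n : ℕ) : (1 : G) ∈ wordBall S n :=
  ⟨[], Nat.zero_le _, by simp, rfl⟩

theorem mem_wordBall_one {g : G} (hg : g ∈ S) : g ∈ wordBall S 1 :=
  ⟨[g], le_rfl, by simpa using Or.inl hg, by simp⟩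

theorem mul_mem_wordBall {g h : G} {n m : ℕ} (hg : g ∈ wordBall S n) (hh : h ∈ wordBall S m) :
    g * h ∈ wordBall S (n + m) := by
  obtain ⟨l, hl, hS, rfl⟩ := hg
  obtain ⟨l', hl', hS', rfl⟩ := hh
  refine ⟨l ++ l', by simpa using Nat.add_le_add hl hl', fun s hs => ?_, by simp⟩
  rcases List.mem_append.1 hs with h | h
  · exact hS s h
  · exact hS' s h

theorem inv_mem_wordBall {g : G} {n : ℕ} (hg : g ∈ wordBall S n) : g⁻¹ ∈ wordBall S n := by
  obtain ⟨l, hl, hS, rfl⟩ := hg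
  refine ⟨(l.map (·⁻¹)).reverse, by simpa using hl, fun s hs => ?_, (List.prod_inv_reverse l).symm⟩
  rw [List.mem_reverse, List.mem_map] at hs
  obtain ⟨t, ht, rfl⟩ := hs
  rw [inv_inv]
  exact (hS t ht).symm

theorem conj_mem_wordBall {g s : G} {n m : ℕ} (hg : g ∈ wordBall S n) (hs : s ∈ wordBall S m) :
    s * g * s⁻¹ ∈ wordBall S (n + 2 * m) :=
  wordBall_mono (by omega)
    (mul_mem_wordBall (mul_mem_wordBall hs hg) (inv_mem_wordBall hs))

theorem wordBall_subset_closure (n : ℕ) : wordBall S n ⊆ Subgroup.closure S := by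
  rintro g ⟨l, -, hS, rfl⟩
  refine Subgroup.list_prod_mem _ fun s hs => ?_
  rcases hS s hs with h | h
  · exact Subgroup.subset_closure h
  · exact (Subgroup.inv_mem_iff _).1 (Subgroup.subset_closure h)

theorem exists_mem_wordBall {g : G} (hg : g ∈ Subgroup.closure S) : ∃ n, g ∈ wordBall S n := by
  induction hg using Subgroup.closure_induction with
  | mem g hg => exact ⟨1, mem_wordBall_one hg⟩
  | one => exact ⟨0, one_mem_wordBall 0⟩
  | mul g h _ _ h1 h2 =>
    obtain ⟨n, hn⟩ := h1
    obtain ⟨m, hm⟩ := h2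
    exact ⟨_, mul_mem_wordBall hn hm⟩
  | inv g _ h1 =>
    obtain ⟨n, hn⟩ := h1
    exact ⟨n, inv_mem_wordBall hn⟩

/-- If a homomorphism maps the ball of radius `c` so that it covers `T`, it maps the ball of radius
`c * n` so that it covers the ball of radius `n` over `T`. -/
theorem wordBall_subset_image {H : Type*} [Group H] (f : G →* H) {T : Set H} {c : ℕ}
    (hT : T ⊆ f '' wordBall S c) (n : ℕ) : wordBall T n ⊆ f '' wordBall S (c * n) := by
  rintro g ⟨l, hl, hlT, rfl⟩
  have key : l.prod ∈ f '' wordBall S (c * l.length) := by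
    clear hl
    induction l with
    | nil => exact ⟨1, one_mem_wordBall _, map_one f⟩
    | cons t l ih =>
      obtain ⟨a, ha, hat⟩ := ih fun s hs => hlT s (List.mem_cons_of_mem _ hs)
      have ht : t ∈ f '' wordBall S c := by
        rcases hlT t List.mem_cons_self with h | h
        · exact hT h
        · obtain ⟨b, hb, hbt⟩ := hT h
          exact ⟨b⁻¹, inv_mem_wordBall hb, by rw [map_inv, hbt, inv_inv]⟩
      obtain ⟨b, hb, hbt⟩ := ht
      refine ⟨b * a, wordBall_mono ?_ (mul_mem_wordBall hb ha), by
        rw [map_mul, hbt, hat, List.prod_cons]⟩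
      rw [List.length_cons]; ring_nf; rfl
  exact Set.image_mono (wordBall_mono (Nat.mul_le_mul_left c hl)) key

theorem finite_wordBall (hS : S.Finite) (n : ℕ) : (wordBall S n).Finite := by
  have hfin : Finite ↑(S ∪ S⁻¹) := (hS.union hS.inv).to_subtype
  refine ((List.finite_length_le (↑(S ∪ S⁻¹)) n).image fun l => (l.map (↑)).prod).subset ?_
  rintro g ⟨l, hl, hlS, rfl⟩
  lift l to List ↑(S ∪ S⁻¹) using hlS
  exact ⟨l, by simpa using hl, rfl⟩

end WordBall

/-! ### Three-cycles of cylinders -/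

/-- The three points `v + a 0`, `v + a 1`, `v + a 2`. -/
def offset (a : Fin 3 → ℤ) (i : Fin 3) (v : ℤ) : ℤ := v + a i

/-- The offsets `j - 1`, `j`, `j + 1`. -/
def around (j : ℤ) : Fin 3 → ℤ := ![j - 1, j, j + 1]

/-- Any two elements of `V` are congruent modulo `P`. -/
def Separated (P : ℕ) (V : Set ℤ) : Prop := ∀ v ∈ V, ∀ w ∈ V, (P : ℤ) ∣ v - w

namespace Separated

variable {P : ℕ} {V : Set ℤ} {a : Fin 3 → ℤ}

theorem eq_of_add_eq (hV : Separated P V) {v w b c : ℤ} (hv : v ∈ V) (hw : w ∈ V) (h : v + b = w + c)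
    (hbc : |b - c| < P) : v = w ∧ b = c := by
  have : v - w = 0 := Int.eq_zero_of_abs_lt_dvd (hV v hv w hw) (by
    rwa [show v - w = -(b - c) by linarith, abs_neg])
  exact ⟨by linarith, by linarith⟩

theorem exists_isCyc (hV : Separated P V) (ha : Function.Injective a) (haP : ∀ i j, |a i - a j| < P) :
    ∃ g, IsCyc V (offset a) g :=
  _root_.exists_isCyc fun _ hv _ hw i j h =>
    have := hV.eq_of_add_eq hv hw h (haP i j)
    ⟨ha this.2, this.1⟩

theorem apply_fix (hV : Separated P V) {g : Equiv.Perm ℤ} (hg : IsCyc V (offset a) g) {v d : ℤ} (hv : v ∈ V)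
    (hd : ∀ i, a i ≠ d) (hdP : ∀ i, |a i - d| < P) : g (v + d) = v + d :=
  hg.fix _ fun _ hw i h => hd i (hV.eq_of_add_eq hw hv h (hdP i)).2

end Separated

theorem around_injective (j : ℤ) : Function.Injective (around j) := by
  intro i i' h
  fin_cases i <;> fin_cases i' <;> simp [around] at h ⊢ <;> omega

theorem abs_around_sub_lt (j : ℤ) (i i' : Fin 3) : |around j i - around j i'| < 3 := by
  rw [abs_lt]
  fin_cases i <;> fin_cases i' <;> (simp [around]; try omega)

/-- Conjugation of a three-cycle by a permutation which acts on its points by changing the offsets. -/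
theorem IsCyc.conj_offset {V : Set ℤ} {a b : Fin 3 → ℤ} {g s : Equiv.Perm ℤ}
    (hg : IsCyc V (offset a) g) (h : ∀ v ∈ V, ∀ i, s (v + a i) = v + b i) :
    IsCyc V (offset b) (s * g * s⁻¹) :=
  (hg.conj s).congr h

/-- The occurrences in `x` of the factor of length `m` that starts at `k`. -/
def cylinder {A : Type*} (x : ℤ → A) (k : ℤ) (m : ℕ) : Set ℤ :=
  {l | ∀ i : ℕ, i < m → x (l + i) = x (k + i)}

theorem self_mem_cylinder {A : Type*} (x : ℤ → A) (k : ℤ) (m : ℕ) : k ∈ cylinder x k m :=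
  fun _ _ => rfl

theorem cylinder_eq_of_mem {A : Type*} {x : ℤ → A} {k l : ℤ} {m : ℕ} (h : l ∈ cylinder x k m) :
    cylinder x l m = cylinder x k m := by
  ext v
  exact ⟨fun hv i hi => (hv i hi).trans (h i hi), fun hv i hi => (hv i hi).trans (h i hi).symm⟩

/-- Equal letters of `x` are at positions congruent modulo `7`. So the points at distance less than
`7` from the occurrences of a word never coincide unless they belong to the same occurrence. -/
def LettersModSeven {A : Type*} (x : ℤ → A) : Prop := ∀ k l, x k = x l → (7 : ℤ) ∣ k - l

section Cylinders

variable {A : Type*} {x : ℤ → A}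

theorem LettersModSeven.separated_cylinder (hx : LettersModSeven x) (k : ℤ) {m : ℕ} (hm : 0 < m) :
    Separated 7 (cylinder x k m) := by
  intro v hv w hw
  have h1 := hv 0 hm
  have h2 := hw 0 hm
  simp only [Nat.cast_zero, add_zero] at h1 h2
  exact hx _ _ (h1.trans h2.symm)

/-- The generators of the derived full group: the three-cycles, on three consecutive points, of the
cylinders of the words of length one and two. -/
def baseCycs (x : ℤ → A) : Set (Equiv.Perm ℤ) :=
  {g | ∃ (k : ℤ) (m j : ℕ), j < m ∧ m ≤ 2 ∧ IsCyc (cylinder x k m) (offset (around j)) g}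

theorem finite_baseCycs [Finite A] : (baseCycs x).Finite := by
  classical
  let c : (Σ m : Fin 3, Fin 3 × (Fin m → A)) → Equiv.Perm ℤ := fun p =>
    if h : ∃ g, ∃ k : ℤ, (∀ i, p.2.2 i = x (k + (i : ℕ))) ∧
      IsCyc (cylinder x k p.1) (offset (around (p.2.1 : ℕ))) g then h.choose else 1
  refine (Set.finite_range c).subset ?_
  rintro g ⟨k, m, j, hj, hm, hg⟩
  refine ⟨⟨⟨m, by omega⟩, ⟨j, by omega⟩, fun i => x (k + (i : ℕ))⟩, ?_⟩
  have h : ∃ g, ∃ l : ℤ, (∀ i : Fin m, x (k + (i : ℕ)) = x (l + (i : ℕ))) ∧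
      IsCyc (cylinder x l m) (offset (around (j : ℕ))) g := ⟨g, k, fun _ => rfl, hg⟩
  change dite _ _ _ = g
  rw [dif_pos h]
  obtain ⟨l, hl, hc⟩ := h.choose_spec
  refine hc.eq_of ?_
  rwa [cylinder_eq_of_mem (k := k) fun i hi => (hl ⟨i, hi⟩).symm]

/-- The three-cycle of a letter `x u` acts near `u`. -/
theorem exists_letterCyc (hx : LettersModSeven x) (k : ℤ) :
    ∃ g ∈ baseCycs x, ∀ u, x u = x k → g (u - 1) = u ∧ g u = u + 1 ∧ g (u + 1) = u - 1 ∧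
      ∀ d : ℤ, 2 ≤ |d| → |d| ≤ 5 → g (u + d) = u + d := by
  have hsep := hx.separated_cylinder k one_pos
  obtain ⟨g, hg⟩ := hsep.exists_isCyc (around_injective ((0 : ℕ) : ℤ))
    fun i j => (abs_around_sub_lt _ i j).trans (by norm_num)
  refine ⟨g, ⟨k, 1, 0, one_pos, by norm_num, hg⟩, fun u hu => ?_⟩
  have huC : u ∈ cylinder x k 1 := fun i hi => by
    obtain rfl : i = 0 := by omega
    simpa using hu
  have h := hg.map u huC
  refine ⟨?_, ?_, ?_, fun d hd1 hd2 => ?_⟩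
  · simpa [offset, around, sub_eq_add_neg] using h 0
  · simpa [offset, around] using h 1
  · simpa [offset, around, sub_eq_add_neg] using h 2
  · rw [le_abs'] at hd1
    rw [abs_le] at hd2
    refine hsep.apply_fix hg huC (fun i => ?_) fun i => ?_
    · fin_cases i <;> simp [around] <;> omega
    · rw [abs_lt]
      fin_cases i <;> simp [around] <;> omega

/-- An element of bounded length that moves the points at offsets `j - 1`, `j`, `j + 1` of a cylinder by
one step: it is a product of the three-cycles of two letters and acts as a five-cycle. -/
theorem exists_shift (hx : LettersModSeven x) (k : ℤ) {m j : ℕ} (hm : 3 ≤ m) (hj : j + 1 < m) :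
    ∃ s ∈ wordBall (baseCycs x) 2, ∀ v ∈ cylinder x k m, ∀ i,
      s (v + around j i) = v + around (j + 1) i := by
  obtain ⟨c, hc, hcm⟩ : ∃ c : ℕ, (j = c ∨ j = c + 1) ∧ c + 2 < m := by
    rcases j with _ | j
    · exact ⟨0, by simp, by omega⟩
    · exact ⟨j, by simp, by omega⟩
  obtain ⟨a, ha, hau⟩ := exists_letterCyc hx (k + c)
  obtain ⟨b, hb, hbu⟩ := exists_letterCyc hx (k + (c + 2 : ℕ))
  refine ⟨a * b, mul_mem_wordBall (mem_wordBall_one ha) (mem_wordBall_one hb), fun v hv i => ?_⟩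
  obtain ⟨a1, a2, a3, a4⟩ := hau _ (hv c (by omega))
  obtain ⟨b1, b2, b3, b4⟩ := hbu _ (hv (c + 2) (by omega))
  set u := v + (c : ℤ) with hu
  have hu2 : v + ((c + 2 : ℕ) : ℤ) = u + 2 := by rw [hu]; push_cast; ring
  rw [hu2] at b1 b2 b4
  have b5 := b4 (-2) (by norm_num) (by norm_num)
  have b6 := b4 (-3) (by norm_num) (by norm_num)
  rw [show u + 2 + -2 = u by ring] at b5
  rw [show u + 2 + -3 = u - 1 by ring] at b6
  rw [show u + 2 - 1 = u + 1 by ring] at b1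
  rw [show u + 2 + 1 = u + 3 by ring] at b2
  have s0 : a (b (u - 1)) = u := by rw [b6, a1]
  have s1 : a (b u) = u + 1 := by rw [b5, a2]
  have s2 : a (b (u + 1)) = u + 2 := by rw [b1, a4 2 (by norm_num) (by norm_num)]
  have s3 : a (b (u + 2)) = u + 3 := by rw [b2, a4 3 (by norm_num) (by norm_num)]
  have eqv : ∀ {p q y z : ℤ}, a (b p) = q → y = p → z = q → a (b y) = z := by
    rintro p q _ _ h rfl rfl; exact h
  rw [Equiv.Perm.mul_apply]
  rcases hc with rfl | rfl <;> fin_cases i <;> simp only [around]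
  · exact eqv s0 (by simp; omega) (by simp; omega)
  · exact eqv s1 (by simp; omega) (by simp; omega)
  · exact eqv s2 (by simp; omega) (by simp; omega)
  · exact eqv s1 (by simp; omega) (by simp; omega)
  · exact eqv s2 (by simp; omega) (by simp; omega)
  · exact eqv s3 (by simp; omega) (by simp; omega)

end Cylinders

/-! ### Generation of the derived subgroup by short three-cycles -/

section Generation

variable {A : Type*} {x : ℤ → A}

/-- The commutator of two three-cycles on `p - 2, p - 1, p` and on `p, p + 1, p + 2` over sets that
agree modulo `7` is a three-cycle around `p` over the intersection. -/
theorem isCyc_inter {V W : Set ℤ} (hVW : ∀ v ∈ V, ∀ w ∈ W, (7 : ℤ) ∣ v - w) {p : ℤ}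
    {g h : Equiv.Perm ℤ} (hg : IsCyc V (offset (around (p - 1))) g)
    (hh : IsCyc W (offset (around (p + 1))) h) :
    IsCyc (V ∩ W) (offset (around p)) (h * g⁻¹ * h⁻¹ * g) := by
  refine (hg.commutator hh (fun v _ => ?_) fun v hv w hw i j h => ?_).congr fun v _ i => ?_
  · simp [offset, around]
  · have h7 := hVW v hv w hw
    have hd : v - w = 2 + j - i := by
      simp only [offset] at h
      fin_cases i <;> fin_cases j <;> simp [around] at h ⊢ <;> omega
    have hi := i.isLt
    have hj := j.isLt
    refine ⟨by omega, Fin.ext ?_, Fin.ext ?_⟩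
    · change (i : ℕ) = 2; omega
    · change (j : ℕ) = 0; omega
  · fin_cases i <;> simp [offset, around]

theorem cylinder_inter {k : ℤ} {m t : ℕ} (ht : t ≤ m) :
    cylinder x k m ∩ {l | l + t ∈ cylinder x (k + t) m} = cylinder x k (t + m) := by
  ext l
  constructor
  · rintro ⟨h1, h2⟩ i hi
    by_cases him : i < m
    · exact h1 i him
    · have := h2 (i - t) (by omega)
      rw [Nat.cast_sub (by omega), add_assoc, add_assoc, add_sub_cancel] at this
      exact this
  · refine fun h => ⟨fun i hi => h i (by omega), fun i hi => ?_⟩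
    have := h (t + i) (by omega)
    push_cast at this
    rwa [← add_assoc, ← add_assoc] at this

/-- Cylinders of words of length `2 ^ s` carry three-cycles of word length at most `9 * 4 ^ s`: doubling
the length of the word multiplies the word length by four, up to the cost of shifting the positions of
the three points along the word. -/
theorem exists_isCyc_cylinder_mem_wordBall (hx : LettersModSeven x) (s : ℕ) (hs : 1 ≤ s) :
    ∃ B : ℕ, B + 8 * 2 ^ s ≤ 9 * 4 ^ s ∧ ∀ (k : ℤ) (j : ℕ), j < 2 ^ s →
      ∃ g ∈ wordBall (baseCycs x) B, IsCyc (cylinder x k (2 ^ s)) (offset (around j)) g := by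
  induction s, hs using Nat.le_induction with
  | base =>
    refine ⟨1, by norm_num, fun k j hj => ?_⟩
    obtain ⟨g, hg⟩ := (hx.separated_cylinder k (m := 2 ^ 1) (by norm_num)).exists_isCyc
      (around_injective j) fun i i' => (abs_around_sub_lt _ i i').trans (by norm_num)
    exact ⟨g, mem_wordBall_one ⟨k, 2 ^ 1, j, hj, by norm_num, hg⟩, hg⟩
  | succ s hs ih =>
    obtain ⟨B, hB, h⟩ := ih
    set m := 2 ^ s with hm
    have hm2 : 2 ≤ m := by
      calc 2 = 2 ^ 1 := rfl
        _ ≤ 2 ^ s := Nat.pow_le_pow_right (by norm_num) hs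
    have h2m : 2 ^ (s + 1) = m + m := by rw [pow_succ, hm]; ring
    rw [h2m]
    refine ⟨4 * B + 8 * m, by rw [pow_succ]; omega, fun k j hj => ?_⟩
    have hmid : ∃ g ∈ wordBall (baseCycs x) (4 * B),
        IsCyc (cylinder x k (m + m)) (offset (around (m : ℕ))) g := by
      obtain ⟨g, hgB, hg⟩ := h k (m - 1) (by omega)
      obtain ⟨f, hfB, hf⟩ := h (k + m) 1 (by omega)
      have hf' : IsCyc {l | l + m ∈ cylinder x (k + m) m} (offset (around ((m : ℤ) + 1))) f :=
        (hf.translate m).congr fun v _ i => by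
          fin_cases i <;> simp [offset, around] <;> ring
      rw [Nat.cast_sub (by omega), Nat.cast_one] at hg
      refine ⟨f * g⁻¹ * f⁻¹ * g, ?_, ?_⟩
      rotate_left
      · rw [← cylinder_inter le_rfl]
        refine isCyc_inter (fun v hv w hw => ?_) hg hf'
        have h1 := hx.separated_cylinder k (by omega : 0 < m) _ hv _ (self_mem_cylinder x k m)
        have h2 := hx.separated_cylinder (k + m) (by omega : 0 < m) _ hw _
          (self_mem_cylinder x _ m)
        push_cast at h1 h2
        omega
      · exact wordBall_mono (by omega) (mul_mem_wordBall (mul_mem_wordBall (mul_mem_wordBall hfB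
          (inv_mem_wordBall hgB)) (inv_mem_wordBall hfB)) hgB)
    have hup : ∀ d : ℕ, m + d < m + m → ∃ g ∈ wordBall (baseCycs x) (4 * B + 4 * d),
        IsCyc (cylinder x k (m + m)) (offset (around ((m + d : ℕ) : ℤ))) g := by
      intro d
      induction d with
      | zero => intro _; simpa using hmid
      | succ d ihd =>
        intro hd
        obtain ⟨g, hgB, hg⟩ := ihd (by omega)
        obtain ⟨t, htB, ht⟩ := exists_shift hx k (m := m + m) (j := m + d) (by omega) (by omega)
        have := hg.conj_offset ht
        exact ⟨_, wordBall_mono (by omega) (conj_mem_wordBall hgB htB), by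
          simpa [add_assoc] using this⟩
    have hdown : ∀ d : ℕ, d ≤ m → ∃ g ∈ wordBall (baseCycs x) (4 * B + 4 * d),
        IsCyc (cylinder x k (m + m)) (offset (around ((m - d : ℕ) : ℤ))) g := by
      intro d
      induction d with
      | zero => intro _; simpa using hmid
      | succ d ihd =>
        intro hd
        obtain ⟨g, hgB, hg⟩ := ihd (by omega)
        obtain ⟨t, htB, ht⟩ := exists_shift hx k (m := m + m) (j := m - (d + 1)) (by omega)
          (by omega)
        have e : ((m - (d + 1) : ℕ) : ℤ) + 1 = ((m - d : ℕ) : ℤ) := by omega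
        rw [e] at ht
        exact ⟨_, wordBall_mono (by omega) (conj_mem_wordBall hgB (inv_mem_wordBall htB)),
          hg.conj_offset fun v hv i => by rw [← ht v hv, perm_inv_apply_apply]⟩
    by_cases hjm : m ≤ j
    · obtain ⟨g, hgB, hg⟩ := hup (j - m) (by omega)
      rw [show m + (j - m) = j by omega] at hg
      exact ⟨g, wordBall_mono (by omega) hgB, hg⟩
    · obtain ⟨g, hgB, hg⟩ := hdown (m - j) (by omega)
      rw [show m - (m - j) = j by omega] at hg
      exact ⟨g, wordBall_mono (by omega) hgB, hg⟩

/-- If `H` contains the three-cycles over `C` on all triples of consecutive offsets, it contains the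
three-cycles over `C` on all triples of offsets. -/
theorem mem_of_consecutive {H : Subgroup (Equiv.Perm ℤ)} {C : Set ℤ} {P n : ℕ}
    (hC : Separated P C) (hP : 2 * n + 2 < P)
    (hcons : ∀ j : ℤ, |j| ≤ n + 1 → ∃ g ∈ H, IsCyc C (offset (around j)) g)
    {a : Fin 3 → ℤ} (ha : Function.Injective a) (han : ∀ i, |a i| ≤ n) {g : Equiv.Perm ℤ}
    (hg : IsCyc C (offset a) g) : g ∈ H := by
  -- triples `(b, b + 1, c)`: `c` moves up by conjugation
  have h1 : ∀ b : ℤ, -n ≤ b → ∀ c, b + 2 ≤ c → c ≤ n →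
      ∃ g ∈ H, IsCyc C (offset ![b, b + 1, c]) g := by
    intro b hb c hc
    induction c, hc using Int.leInduction with
    | base =>
      intro hn
      obtain ⟨g, hgH, hg⟩ := hcons (b + 1) (by rw [abs_le]; constructor <;> omega)
      refine ⟨g, hgH, hg.congr fun v _ i => ?_⟩
      fin_cases i <;> simp [offset, around]; ring
    | succ c hc ih =>
      intro hn
      obtain ⟨g, hgH, hg⟩ := ih (by omega)
      obtain ⟨t, htH, ht⟩ := hcons (c + 1) (by rw [abs_le]; constructor <;> omega)
      have hfix : ∀ v ∈ C, ∀ d, b ≤ d → d < c → t (v + d) = v + d := by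
        intro v hv d hbd hdc
        refine hC.apply_fix ht hv (fun i => ?_) fun i => ?_
        · fin_cases i <;> simp [around] <;> omega
        · rw [abs_lt]
          fin_cases i <;> simp [around] <;> omega
      refine ⟨_, mul_mem (mul_mem htH hgH) (inv_mem htH), hg.conj_offset fun v hv i => ?_⟩
      fin_cases i
      · exact hfix v hv b le_rfl (by omega)
      · exact hfix v hv (b + 1) (by omega) (by omega)
      · have := ht.map v hv 0
        simpa [offset, around] using this
  -- triples with smallest entry in front
  have h2 : ∀ b c d : ℤ, -n ≤ b → b < c → b < d → c ≠ d → c ≤ n → d ≤ n →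
      ∃ g ∈ H, IsCyc C (offset ![b, c, d]) g := by
    intro b c d hb hbc hbd hcd hc hd
    by_cases hc1 : c = b + 1
    · subst hc1
      exact h1 b hb d (by omega) hd
    by_cases hd1 : d = b + 1
    · subst hd1
      obtain ⟨g, hgH, hg⟩ := h1 b hb c (by omega) hc
      refine ⟨g⁻¹, inv_mem hgH, hg.inv.congr fun v _ i => ?_⟩
      fin_cases i <;> rfl
    obtain ⟨g, hgH, hg⟩ := h1 b hb c (by omega) hc
    obtain ⟨f, hfH, hf⟩ := h1 b hb d (by omega) hd
    refine ⟨f⁻¹ * g * f⁻¹⁻¹, mul_mem (mul_mem (inv_mem hfH) hgH) (inv_mem (inv_mem hfH)), ?_⟩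
    have := (hg.conj_offset (s := f⁻¹) (b := ![d, b, c]) fun v hv i => ?_).rotate 1
    · refine this.congr fun v _ i => ?_
      fin_cases i <;> rfl
    · fin_cases i
      · exact hf.inv_map hv 2
      · exact hf.inv_map hv 0
      · change f⁻¹ (v + c) = v + c
        rw [Equiv.Perm.inv_eq_iff_eq]
        refine (hC.apply_fix hf hv (fun i => ?_) fun i => ?_).symm
        · fin_cases i <;> simp <;> omega
        · rw [abs_lt]
          fin_cases i <;> simp <;> omega
  -- rotate the smallest entry to the front
  obtain ⟨i, hi⟩ : ∃ i, ∀ j, a i ≤ a j := Finite.exists_min a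
  have hne : ∀ j, j ≠ i → a i < a j := fun j hj =>
    lt_of_le_of_ne (hi j) fun h => hj (ha h.symm)
  have hb := fun i => abs_le.1 (han i)
  have n1 : 1 + i ≠ i := (by decide : ∀ i : Fin 3, 1 + i ≠ i) i
  have n2 : 2 + i ≠ i := (by decide : ∀ i : Fin 3, 2 + i ≠ i) i
  have n3 : 1 + i ≠ 2 + i := (by decide : ∀ i : Fin 3, 1 + i ≠ 2 + i) i
  obtain ⟨f, hfH, hf⟩ := h2 (a i) (a (1 + i)) (a (2 + i)) (hb i).1 (hne _ n1) (hne _ n2)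
    (fun h => n3 (ha h)) (hb _).2 (hb _).2
  have hg' : IsCyc C (offset ![a i, a (1 + i), a (2 + i)]) g := by
    refine (hg.rotate i).congr fun v _ j => ?_
    fin_cases j
    · change v + a (0 + i) = v + a i
      rw [zero_add]
    · rfl
    · rfl
  rw [hg'.eq_of hf]
  exact hfH

theorem threeCycleGroup_le_closure [Finite A] (hx : LettersModSeven x) (hper : HasPeriods x) :
    threeCycleGroup x ≤ Subgroup.closure (baseCycs x) := by
  rw [threeCycleGroup, Subgroup.closure_le]
  rintro g ⟨n, V, e, hV, hg⟩
  obtain ⟨P, n₀, hP, hres⟩ := hper (2 * n + 2)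
  -- `C k` consists of the positions that look like `k` in a long window
  set ρ := n + n₀ + 2 with hρ
  obtain ⟨s, hs⟩ : ∃ s, 2 * ρ + 1 ≤ 2 ^ (s + 1) := ⟨2 * ρ, by
    have := Nat.lt_two_pow_self (n := 2 * ρ + 1); omega⟩
  set m := 2 ^ (s + 1) with hm
  let C : ℤ → Set ℤ := fun k => {l | l + -ρ ∈ cylinder x (k + -ρ) m}
  have hself : ∀ k, k ∈ C k := fun k => self_mem_cylinder x _ m
  have hCeq : ∀ k l, l ∈ C k → C l = C k := fun k l h => by
    simp only [C, cylinder_eq_of_mem h]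
  have hCwin : ∀ k l, l ∈ C k → WindowEq x ρ l k := by
    intro k l h i hi
    rw [abs_le] at hi
    have := h (ρ + i).toNat (by omega)
    rw [Int.toNat_of_nonneg (by omega)] at this
    convert this using 2 <;> ring
  have hCof : ∀ k l, WindowEq x (ρ + m) k l → C k = C l := by
    intro k l h
    refine hCeq l k fun i hi => ?_
    have := h (-ρ + i) (by rw [abs_le]; push_cast; constructor <;> omega)
    rwa [← add_assoc, ← add_assoc] at this
  have hCsep : ∀ k, Separated P (C k) := fun k v hv w hw =>
    hres _ _ ((hCwin w v (by rwa [hCeq k w hw])).mono (by omega))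
  have hCV : ∀ k ∈ V, C k ⊆ V := fun k hk l hl =>
    hV.mem k l ((hCwin k l hl).symm.mono (by omega)) hk
  have hcons : ∀ k, ∀ j : ℤ, |j| ≤ n + 1 →
      ∃ g ∈ Subgroup.closure (baseCycs x), IsCyc (C k) (offset (around j)) g := by
    intro k j hj
    rw [abs_le] at hj
    obtain ⟨B, -, hB⟩ := exists_isCyc_cylinder_mem_wordBall hx (s + 1) (by omega)
    obtain ⟨f, hfB, hf⟩ := hB (k + -ρ) (j + ρ).toNat (by omega)
    refine ⟨f, wordBall_subset_closure _ hfB, (hf.translate (-ρ)).congr fun v _ i => ?_⟩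
    rw [Int.toNat_of_nonneg (by omega)]
    fin_cases i <;> simp [offset, around] <;> ring
  -- on each `C k ⊆ V` the cycle has constant offsets
  have hpiece : ∀ k ∈ V, ∀ f, IsCyc (C k) e f → f ∈ Subgroup.closure (baseCycs x) := by
    intro k hk f hf
    have hconst : ∀ v ∈ C k, ∀ i, e i v = offset (fun i => e i k - k) i v := fun v hv i => by
      have := hV.disp k v ((hCwin k v hv).symm.mono (by omega)) hk i
      simp only [offset]; linarith
    refine mem_of_consecutive (hCsep k) hP (hcons k) (fun i j hij => ?_) (hV.bound k hk)
      (hf.congr hconst)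
    exact (hg.inj k hk k hk i j (by simpa using hij)).1
  have hfin : (Set.range C).Finite := finite_range_of_windowEq hCof
  have hind : ∀ F : Set (Set ℤ), F.Finite → F ⊆ Set.range C → ∀ f, IsCyc (V ∩ ⋃₀ F) e f →
      f ∈ Subgroup.closure (baseCycs x) := by
    intro F hF
    induction F, hF using Set.Finite.induction_on with
    | empty =>
      intro _ f hf
      have : f = 1 := by
        ext k
        exact hf.fix k fun v hv => absurd hv.2 (by simp)
      rw [this]; exact one_mem _
    | @insert D F hDF _ ih =>
      intro hsub f hf
      have hF' : F ⊆ Set.range C := (Set.subset_insert _ _).trans hsub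
      obtain ⟨k, rfl⟩ := hsub (Set.mem_insert _ _)
      by_cases hk : k ∈ V
      · have hset : V ∩ ⋃₀ insert (C k) F = C k ∪ (V ∩ ⋃₀ F) := by
          rw [Set.sUnion_insert, Set.inter_union_distrib_left, Set.inter_eq_right.2 (hCV k hk)]
        rw [hset] at hf
        obtain ⟨f₁, hf₁⟩ := hf.subset Set.subset_union_left
        obtain ⟨f₂, hf₂⟩ := hf.subset Set.subset_union_right
        have hdisj : Disjoint (C k) (V ∩ ⋃₀ F) := by
          rw [Set.disjoint_left]
          rintro l hl ⟨-, D, hD, hlD⟩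
          obtain ⟨k', rfl⟩ := hF' hD
          exact hDF (by rwa [← hCeq k l hl, hCeq k' l hlD])
        rw [hf.eq_mul_of_union hdisj hf₁ hf₂]
        exact mul_mem (hpiece k hk _ hf₁) (ih hF' _ hf₂)
      · refine ih hF' f ?_
        convert hf using 1
        rw [Set.sUnion_insert, Set.inter_union_distrib_left]
        have : V ∩ C k = ∅ := by
          rw [Set.eq_empty_iff_forall_notMem]
          rintro l ⟨hlV, hlC⟩
          exact hk (hCV l hlV (by rw [hCeq k l hlC]; exact hself k))
        rw [this, Set.empty_union]
  refine hind _ hfin subset_rfl g ?_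
  have huniv : ⋃₀ Set.range C = Set.univ :=
    Set.eq_univ_of_forall fun k => ⟨C k, ⟨k, rfl⟩, hself k⟩
  rwa [huniv, Set.inter_univ]

theorem localData_cylinder (k : ℤ) (m : ℕ) (j : ℤ) :
    LocalData x (m + j.natAbs + 1) (cylinder x k m) (offset (around j)) where
  mem k l hkl hk i hi := by
    rw [← hk i hi]
    exact (hkl i (by rw [Nat.abs_cast]; omega)).symm
  bound v _ i := by
    have h1 := le_abs_self j
    have h2 := neg_le_abs j
    rw [abs_le]
    fin_cases i <;> simp [offset, around] <;> omega
  disp k l _ _ i := by simp [offset]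

theorem baseCycs_subset_commutator (hx : LettersModSeven x) :
    baseCycs x ⊆ (⁅localGroup x, localGroup x⁆ : Subgroup (Equiv.Perm ℤ)) := by
  rintro g ⟨k, m, j, hj, hm, hg⟩
  have hsep := hx.separated_cylinder k (by omega : 0 < m)
  have hex : ∀ p : ℤ, ∃ f ∈ localGroup x, IsCyc (cylinder x k m) (offset (around p)) f := by
    intro p
    obtain ⟨f, hf⟩ := hsep.exists_isCyc (around_injective p)
      fun i i' => (abs_around_sub_lt _ i i').trans (by norm_num)
    exact ⟨f, ⟨_, hf.localWithin (localData_cylinder k m p)⟩, hf⟩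
  obtain ⟨a, haG, ha⟩ := hex (j - 1)
  obtain ⟨b, hbG, hb⟩ := hex (j + 1)
  have h := isCyc_inter hsep ha hb
  rw [Set.inter_self] at h
  rw [hg.eq_of h]
  have := Subgroup.commutator_mem_commutator hbG (inv_mem haG)
  rwa [commutatorElement_def, inv_inv] at this

/-- The derived subgroup of the group of local permutations is generated by three-cycles of cylinders of
words of length at most two. -/
theorem commutator_localGroup_eq [Finite A] (hx : LettersModSeven x) (hper : HasPeriods x) :
    ⁅localGroup x, localGroup x⁆ = Subgroup.closure (baseCycs x) :=
  le_antisymm ((commutator_localGroup_le hper).trans (threeCycleGroup_le_closure hx hper))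
    ((Subgroup.closure_le _).2 (baseCycs_subset_commutator hx))

end Generation

/-! ### Lower bound for the LEF growth -/

/-- A finite group that contains `n` pairwise commuting noncommutative subgroups has order at least
`2 ^ n`: adjoining them one after the other, the generated subgroup grows strictly in each step. -/
theorem two_pow_card_le_of_commute {Q ι : Type*} [Group Q] [Finite Q] [DecidableEq ι] (F : Finset ι)
    (a b : ι → Q) (hne : ∀ i ∈ F, a i * b i ≠ b i * a i)
    (hcomm : ∀ i ∈ F, ∀ j ∈ F, i ≠ j → Commute (b i) (a j) ∧ Commute (b i) (b j)) :
    2 ^ F.card ≤ Nat.card Q := by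
  let K : Finset ι → Subgroup Q := fun F => Subgroup.closure (a '' F ∪ b '' F)
  have hmono : ∀ F G : Finset ι, F ⊆ G → K F ≤ K G := fun F G h =>
    Subgroup.closure_mono (Set.union_subset_union (Set.image_mono (by exact_mod_cast h))
      (Set.image_mono (by exact_mod_cast h)))
  have key : 2 ^ F.card ≤ Nat.card (K F) := by
    induction F using Finset.induction_on with
    | empty => simpa using Nat.one_le_iff_ne_zero.2 Nat.card_pos.ne'
    | insert i F hi ih =>
      have hF := ih (fun j hj => hne j (Finset.mem_insert_of_mem hj)) fun j hj l hl =>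
        hcomm j (Finset.mem_insert_of_mem hj) l (Finset.mem_insert_of_mem hl)
      have hle : K F ≤ K (insert i F) := hmono _ _ (Finset.subset_insert _ _)
      have hai : a i ∈ K (insert i F) :=
        Subgroup.subset_closure (Or.inl ⟨i, by simp, rfl⟩)
      have hcent : K F ≤ Subgroup.centralizer {b i} := by
        rw [Subgroup.closure_le]
        rintro _ (⟨j, hj, rfl⟩ | ⟨j, hj, rfl⟩)
        all_goals
          have hj' : j ∈ F := hj
          have h := hcomm i (Finset.mem_insert_self _ _) j (Finset.mem_insert_of_mem hj')
            (fun h => hi (h ▸ hj'))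
          rw [SetLike.mem_coe, Subgroup.mem_centralizer_singleton_iff]
        · exact h.1.symm
        · exact h.2.symm
      have hnot : a i ∉ K F := fun h =>
        hne i (Finset.mem_insert_self _ _) (Subgroup.mem_centralizer_singleton_iff.1 (hcent h))
      obtain ⟨c, hc⟩ := Subgroup.card_dvd_of_le hle
      have hpos : 0 < Nat.card (K (insert i F)) := Nat.card_pos
      have hc1 : c ≠ 1 := by
        rintro rfl
        refine hnot ?_
        rw [Subgroup.eq_of_le_of_card_ge hle (by rw [hc, mul_one])]
        exact hai
      have hc0 : c ≠ 0 := by rintro rfl; omega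
      rw [Finset.card_insert_of_notMem hi, pow_succ, hc]
      exact Nat.mul_le_mul hF (by omega)
  exact key.trans (Subgroup.card_le_card_group _)

/-- For each word of length `2 ^ s` with a given first letter there are two noncommuting three-cycles
of its cylinder, of length polynomial in `2 ^ s`, and those of different words commute. So a local
embedding of a large ball needs a finite group of order exponential in the complexity. -/
theorem exists_two_pow_le_card_of_isLocalEmbedding {A : Type*} [Fintype A] {x : ℤ → A}
    (hx : LettersModSeven x) {Γ : Type*} [Group Γ] {ψ : Γ →* Equiv.Perm ℤ}
    (hψ : Function.Injective ψ) (hbase : baseCycs x ⊆ Set.range ψ) {S : Set Γ}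
    (hS : Subgroup.closure S = ⊤) :
    ∃ c : ℕ, 0 < c ∧ ∀ s : ℕ, 1 ≤ s → ∀ (Q : Type) [Group Q] [Finite Q] (φ : Γ → Q),
      IsLocalEmbedding (wordBall S (c * 4 ^ s)) φ →
      ∃ q : ℕ, complexity x (2 ^ s) ≤ Fintype.card A * q ∧ 2 ^ q ≤ Nat.card Q := by
  classical
  have hex : ∀ t ∈ baseCycs x, ∃ n, t ∈ ψ '' wordBall S n := by
    intro t ht
    obtain ⟨γ, rfl⟩ := hbase ht
    obtain ⟨n, hn⟩ := exists_mem_wordBall (S := S) (g := γ) (by rw [hS]; trivial)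
    exact ⟨n, γ, hn, rfl⟩
  choose! r hr using hex
  obtain ⟨c₀, hc₀⟩ := ((finite_baseCycs (x := x)).image r).bddAbove
  have hT : baseCycs x ⊆ ψ '' wordBall S c₀ := fun t ht =>
    Set.image_mono (wordBall_mono (hc₀ (Set.mem_image_of_mem r ht))) (hr t ht)
  refine ⟨18 * c₀ + 1, by omega, fun s hs Q _ _ φ hφ => ?_⟩
  obtain ⟨B, hB, hcyc⟩ := exists_isCyc_cylinder_mem_wordBall hx s hs
  set m := 2 ^ s with hm
  have hm1 : 1 < m := Nat.one_lt_two_pow (by omega)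
  set n := c₀ * (9 * 4 ^ s) with hn
  have hball : wordBall (baseCycs x) B ⊆ ψ '' wordBall S n :=
    (wordBall_subset_image ψ hT B).trans
      (Set.image_mono (wordBall_mono (Nat.mul_le_mul_left _ (by omega))))
  have hex : ∀ j : ℕ, j < m → ∀ k : ℤ,
      ∃ γ ∈ wordBall S n, IsCyc (cylinder x k m) (offset (around j)) (ψ γ) := by
    intro j hj k
    obtain ⟨g, hg, hgc⟩ := hcyc k j hj
    obtain ⟨γ, hγ, rfl⟩ := hball hg
    exact ⟨γ, hγ, hgc⟩
  choose α hα hαc using hex 0 (by omega)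
  choose β hβ hβc using hex 1 hm1
  have h2n : n + n ≤ (18 * c₀ + 1) * 4 ^ s := by rw [hn]; ring_nf; omega
  have hmem : ∀ γ ∈ wordBall S n, γ ∈ wordBall S ((18 * c₀ + 1) * 4 ^ s) := fun γ h =>
    wordBall_mono (by omega) h
  have hmul : ∀ γ ∈ wordBall S n, ∀ δ ∈ wordBall S n, φ (γ * δ) = φ γ * φ δ := fun γ h δ h' =>
    hφ.2 γ (hmem γ h) δ (hmem δ h') (wordBall_mono h2n (mul_mem_wordBall h h'))
  -- three-cycles over different words with the same first letter have disjoint supports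
  have hdisj : ∀ k l : ℤ, x k = x l → cylinder x k m ≠ cylinder x l m → ∀ (i j : ℤ), |i - j| ≤ 1 →
      ∀ g h, IsCyc (cylinder x k m) (offset (around i)) g →
        IsCyc (cylinder x l m) (offset (around j)) h → Commute g h := by
    intro k l hkl hne i j hij g h hg hh
    refine Equiv.Perm.Disjoint.commute fun u => ?_
    by_contra! hu
    have h1 : ∃ v ∈ cylinder x k m, ∃ p, offset (around i) p v = u := by
      by_contra! h; exact hu.1 (hg.fix u h)
    have h2 : ∃ v ∈ cylinder x l m, ∃ p, offset (around j) p v = u := by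
      by_contra! h; exact hu.2 (hh.fix u h)
    obtain ⟨v, hv, p, hvp⟩ := h1
    obtain ⟨w, hw, p', hwp⟩ := h2
    have hv0 := hv 0 (by omega)
    have hw0 := hw 0 (by omega)
    simp only [Nat.cast_zero, add_zero] at hv0 hw0
    have h7 := hx v w (by rw [hv0, hw0, hkl])
    have hvw : v = w := by
      rw [abs_le] at hij
      rw [← hwp] at hvp
      simp only [offset] at hvp
      fin_cases p <;> fin_cases p' <;> simp [around] at hvp <;> omega
    subst hvw
    exact hne ((cylinder_eq_of_mem hv).symm.trans (cylinder_eq_of_mem hw))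
  have hnc : ∀ k, φ (α k) * φ (β k) ≠ φ (β k) * φ (α k) := by
    intro k h
    rw [← hmul _ (hα k) _ (hβ k), ← hmul _ (hβ k) _ (hα k)] at h
    have h := hφ.1 (wordBall_mono h2n (mul_mem_wordBall (hα k) (hβ k)))
      (wordBall_mono h2n (mul_mem_wordBall (hβ k) (hα k))) h
    have h := congrArg (fun γ => ψ γ (k + (-1))) h
    simp only [map_mul, Equiv.Perm.mul_apply] at h
    have hk := self_mem_cylinder x k m
    have a0 := (hαc k).map k hk 0
    have b0 := (hβc k).map k hk 0
    have bfix := (hx.separated_cylinder k (by omega)).apply_fix (hβc k) hk (d := -1)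
      (fun i => by fin_cases i <;> simp [around]) (fun i => by
        rw [abs_lt]; fin_cases i <;> simp [around])
    simp [offset, around] at a0 b0 bfix
    rw [bfix, a0, b0] at h
    omega
  -- the words with the most frequent first letter
  have hfin : (factors x m).Finite := Set.toFinite _
  let W := hfin.toFinset
  have : Nonempty A := ⟨x 0⟩
  obtain ⟨a, ha⟩ := Finite.exists_max fun a : A => (W.filter fun w => w ⟨0, by omega⟩ = a).card
  let F := W.filter fun w => w ⟨0, by omega⟩ = a
  refine ⟨F.card, ?_, ?_⟩
  · rw [complexity, Set.ncard_eq_toFinset_card _ hfin,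
      Finset.card_eq_sum_card_fiberwise (f := fun w => w ⟨0, by omega⟩) (t := Finset.univ)
        fun w _ => Finset.mem_univ _]
    refine (Finset.sum_le_card_nsmul _ _ F.card fun b _ => ha b).trans ?_
    rw [Finset.card_univ, smul_eq_mul]
  · have hpos : ∀ w : Fin m → A, w ∈ F → ∃ k : ℤ, ∀ i : Fin m, w i = x (k + (i : ℕ)) := by
      intro w hw
      exact hfin.mem_toFinset.1 (Finset.mem_filter.1 hw).1
    choose! k hk using hpos
    have hfirst : ∀ w ∈ F, x (k w) = a := fun w hw => by
      rw [← (Finset.mem_filter.1 hw).2, hk w hw]; simp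
    have hcyl : ∀ w ∈ F, ∀ w' ∈ F, w ≠ w' → cylinder x (k w) m ≠ cylinder x (k w') m := by
      intro w hw w' hw' hne h
      refine hne (funext fun i => ?_)
      have := h ▸ self_mem_cylinder x (k w) m
      rw [hk w hw, hk w' hw']
      exact this i i.isLt
    have hcommφ : ∀ γ ∈ wordBall S n, ∀ δ ∈ wordBall S n, Commute (ψ γ) (ψ δ) →
        Commute (φ γ) (φ δ) := by
      intro γ hγ δ hδ h
      have h' : γ * δ = δ * γ := hψ (by rw [map_mul, map_mul]; exact h)
      rw [Commute, SemiconjBy, ← hmul γ hγ δ hδ, h', hmul δ hδ γ hγ]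
    refine two_pow_card_le_of_commute F (fun w => φ (α (k w))) (fun w => φ (β (k w)))
      (fun w _ => hnc _) fun w hw w' hw' hne => ?_
    have h1 := (hfirst w hw).trans (hfirst w' hw').symm
    exact ⟨hcommφ _ (hβ _) _ (hα _) (hdisj _ _ h1 (hcyl w hw w' hw' hne) _ _ (by norm_num) _ _
        (hβc _) (hαc _)),
      hcommφ _ (hβ _) _ (hβ _) (hdisj _ _ h1 (hcyl w hw w' hw' hne) _ _ (by norm_num) _ _
        (hβc _) (hβc _))⟩

/-! ### Upper bound for the LEF growth -/

/-- A uniformly recurrent word has a long-period approximation which has the same words of length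
`2 * N + 1`: here `κ t` is a position of `x` that looks like the position `t` of a periodic word of
period `L`. -/
theorem exists_periodic_model {A : Type*} {x : ℤ → A} (hx : IsUniformlyRecurrent x) (N : ℕ) :
    ∃ (L : ℕ) (κ : ℤ → ℤ), L ≤ 2 * recurrence x (4 * N + 1) ∧ 2 * N < L ∧
      (∀ t, κ (t % L) = κ t) ∧
      (∀ t d : ℤ, |d| ≤ N → WindowEq x N (κ t + d) (κ (t + d))) ∧
      ∀ k, ∃ t, WindowEq x N (κ t) k := by
  obtain ⟨M, hM⟩ := hx (4 * N + 1)
  have hR : RecursWithin x (4 * N + 1) (recurrence x (4 * N + 1)) :=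
    Nat.sInf_mem (s := {M | RecursWithin x (4 * N + 1) M}) ⟨M, hM⟩
  set R := recurrence x (4 * N + 1)
  have hocc : ∀ k l : ℤ, ∃ p : ℕ, p + (4 * N + 1) ≤ R ∧
      ∀ i : ℕ, i < 4 * N + 1 → x (k + i) = x (l + p + i) := by
    intro k l
    obtain ⟨p, hp, h⟩ := hR (fun i => x (k + (i : ℕ))) ⟨k, fun _ => rfl⟩
      (fun i => x (l + (i : ℕ))) ⟨l, fun _ => rfl⟩
    refine ⟨p, hp, fun i hi => (h ⟨i, hi⟩).trans ?_⟩
    push_cast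
    rw [add_assoc]
  obtain ⟨p, hp, hpx⟩ := hocc 0 R
  set L := R + p with hL
  have hL0 : (0 : ℤ) < L := by omega
  have hrep : ∀ i : ℤ, 0 ≤ i → i ≤ 4 * N → x i = x (L + i) := by
    intro i h0 h1
    lift i to ℕ using h0
    have := hpx i (by omega)
    rw [zero_add] at this
    rw [this, hL]; push_cast; rfl
  let y : ℤ → A := fun u => x (2 * N + u % L)
  have hy : ∀ t i : ℤ, |i| ≤ 2 * N → x (2 * N + t % L + i) = y (t + i) := by
    intro t i hi
    rw [abs_le] at hi
    have h0 := Int.emod_nonneg t hL0.ne'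
    have h1 := Int.emod_lt_of_pos t hL0
    simp only [y]
    rw [← Int.emod_add_emod]
    set t₀ := t % L
    rcases lt_or_ge (t₀ + i) 0 with h | h
    · rw [← Int.add_emod_right, Int.emod_eq_of_lt (by omega) (by omega), add_assoc,
        hrep (2 * N + (t₀ + i)) (by omega) (by omega)]
      congr 1; ring
    rcases lt_or_ge (t₀ + i) L with h' | h'
    · rw [Int.emod_eq_of_lt h h', add_assoc]
    · rw [← Int.sub_emod_right, Int.emod_eq_of_lt (by omega) (by omega),
        hrep (2 * N + (t₀ + i - L)) (by omega) (by omega)]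
      congr 1; ring
  refine ⟨L, fun t => 2 * N + t % L, by omega, by omega, fun t => ?_, fun t d hd i hi => ?_,
    fun k => ?_⟩
  · simp only [Int.emod_emod_of_dvd _ dvd_rfl]
  · rw [add_assoc, hy t (d + i) ((abs_add_le _ _).trans (by omega)),
      hy (t + d) i (by omega), add_assoc]
  · obtain ⟨p, hp, hpx⟩ := hocc (k - 2 * N) 0
    refine ⟨p, fun i hi => ?_⟩
    rw [abs_le] at hi
    have := hpx (2 * N + i).toNat (by omega)
    rw [Int.toNat_of_nonneg (by omega)] at this
    change x (2 * N + (p : ℤ) % L + i) = _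
    rw [Int.emod_eq_of_lt (by omega) (by omega)]
    convert this.symm using 2 <;> ring

/-- Permutations that are local within `N`, together with their inverses, act on a periodic
approximation of the word, and this action is a local embedding. -/
theorem exists_isLocalEmbedding_zmod {A : Type*} {x : ℤ → A} (hx : IsUniformlyRecurrent x) (N : ℕ) :
    ∃ (L : ℕ) (φ : Equiv.Perm ℤ → Equiv.Perm (ZMod L)), 0 < L ∧ L ≤ 2 * recurrence x (4 * N + 1) ∧
      IsLocalEmbedding {g | LocalWithin x N g ∧ LocalWithin x N g⁻¹} φ := by
  classical
  obtain ⟨L, κ, hLR, hNL, hκ, hwin, hsurj⟩ := exists_periodic_model hx N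
  have : NeZero L := ⟨by omega⟩
  let F : Equiv.Perm ℤ → ℤ → ℤ := fun g t => t + (g (κ t) - κ t)
  have hFmul : ∀ g h, LocalWithin x N g → LocalWithin x N h → ∀ t, F (g * h) t = F g (F h t) := by
    intro g h hg hh t
    have hd := hh.1 (κ t)
    have h1 := hg.2 _ _ (hwin t _ hd)
    rw [add_sub_cancel] at h1
    simp only [F, Equiv.Perm.mul_apply]
    linarith
  let f : Equiv.Perm ℤ → ZMod L → ZMod L := fun g u => (F g (u.val : ℤ) : ℤ)
  have hfF : ∀ g (t : ℤ), f g t = (F g t : ℤ) := by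
    intro g t
    simp only [f, F, ZMod.val_intCast, hκ]
    push_cast
    rfl
  have hfmul : ∀ g h, LocalWithin x N g → LocalWithin x N h → ∀ u, f (g * h) u = f g (f h u) := by
    intro g h hg hh u
    obtain ⟨t, rfl⟩ := ZMod.intCast_surjective u
    rw [hfF (g * h) t, hfF h t, hfF g (F h t), hFmul g h hg hh]
  have hf1 : ∀ u, f 1 u = u := by
    intro u
    obtain ⟨t, rfl⟩ := ZMod.intCast_surjective u
    rw [hfF]; simp [F]
  have hbij : ∀ g, LocalWithin x N g ∧ LocalWithin x N g⁻¹ → Function.Bijective (f g) := by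
    rintro g ⟨h1, h2⟩
    refine Function.bijective_iff_has_inverse.2 ⟨f g⁻¹, fun u => ?_, fun u => ?_⟩
    · rw [← hfmul _ _ h2 h1, inv_mul_cancel, hf1]
    · rw [← hfmul _ _ h1 h2, mul_inv_cancel, hf1]
  let φ : Equiv.Perm ℤ → Equiv.Perm (ZMod L) := fun g =>
    if h : Function.Bijective (f g) then Equiv.ofBijective (f g) h else 1
  have hφ : ∀ g, LocalWithin x N g ∧ LocalWithin x N g⁻¹ → ∀ u, φ g u = f g u := by
    intro g hg u
    simp only [φ]
    rw [dif_pos (hbij g hg)]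
    rfl
  refine ⟨L, φ, by omega, hLR, ?_, ?_⟩
  · intro g hg h hh hgh
    ext k
    obtain ⟨t, ht⟩ := hsurj k
    have h1 : f g t = f h t := by rw [← hφ g hg, ← hφ h hh, hgh]
    rw [hfF, hfF, ZMod.intCast_eq_intCast_iff_dvd_sub] at h1
    simp only [F] at h1
    rw [hg.1.2 _ _ ht, hh.1.2 _ _ ht] at h1
    have h2 := abs_le.1 (hg.1.1 k)
    have h3 := abs_le.1 (hh.1.1 k)
    have := Int.eq_zero_of_abs_lt_dvd h1 (by rw [abs_lt]; constructor <;> omega)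
    omega
  · intro g hg h hh hgh
    ext u
    rw [Equiv.Perm.mul_apply, hφ _ hgh, hφ g hg, hφ h hh, hfmul g h hg.1 hh.1]

theorem localWithin_of_mem_wordBall {A : Type*} {x : ℤ → A} {Γ : Type*} [Group Γ]
    (ψ : Γ →* Equiv.Perm ℤ) {S : Set Γ} {c : ℕ}
    (hc : ∀ s ∈ S, LocalWithin x c (ψ s) ∧ LocalWithin x c (ψ s⁻¹)) {n : ℕ} {g : Γ}
    (hg : g ∈ wordBall S n) : LocalWithin x (c * n) (ψ g) := by
  obtain ⟨l, hl, hS, rfl⟩ := hg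
  refine LocalWithin.mono (n := c * l.length) ?_ (Nat.mul_le_mul_left c hl)
  clear hl
  induction l with
  | nil => simpa using LocalWithin.one x 0
  | cons s l ih =>
    have h1 := ih fun t ht => hS t (List.mem_cons_of_mem _ ht)
    have h2 : LocalWithin x c (ψ s) := by
      rcases hS s List.mem_cons_self with h | h
      · exact (hc s h).1
      · simpa using (hc _ h).2
    rw [List.prod_cons, map_mul, List.length_cons]
    exact (h2.mul h1).mono (by ring_nf; rfl)

/-- A ball of radius `n` in a group of local permutations embeds locally into a symmetric group whose
degree is at most twice the value of the recurrence function at some linear expression in `n`. -/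
theorem exists_isLocalEmbedding_wordBall {A : Type*} {x : ℤ → A} (hx : IsUniformlyRecurrent x)
    {Γ : Type*} [Group Γ] {ψ : Γ →* Equiv.Perm ℤ} (hψ : Function.Injective ψ)
    (hloc : ∀ g, ψ g ∈ localGroup x) {S : Set Γ} (hS : S.Finite) :
    ∃ c : ℕ, 0 < c ∧ ∀ n : ℕ, ∃ (L : ℕ) (φ : Γ → Equiv.Perm (ZMod L)), 0 < L ∧
      L ≤ 2 * recurrence x (4 * (c * n) + 1) ∧ IsLocalEmbedding (wordBall S n) φ := by
  choose r hr using hloc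
  obtain ⟨c₁, hc₁⟩ := (hS.image r).bddAbove
  obtain ⟨c₂, hc₂⟩ := (hS.image fun s => r s⁻¹).bddAbove
  have hc : ∀ s ∈ S, LocalWithin x (c₁ + c₂ + 1) (ψ s) ∧ LocalWithin x (c₁ + c₂ + 1) (ψ s⁻¹) := by
    intro s hs
    have h1 := hc₁ (Set.mem_image_of_mem r hs)
    have h2 := hc₂ (Set.mem_image_of_mem (fun s => r s⁻¹) hs)
    exact ⟨(hr s).mono (by omega), (hr s⁻¹).mono (by omega)⟩
  refine ⟨c₁ + c₂ + 1, by omega, fun n => ?_⟩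
  obtain ⟨L, φ, hL0, hL, hφ⟩ := exists_isLocalEmbedding_zmod hx ((c₁ + c₂ + 1) * n)
  have hmem : ∀ g ∈ wordBall S n, LocalWithin x ((c₁ + c₂ + 1) * n) (ψ g) ∧
      LocalWithin x ((c₁ + c₂ + 1) * n) (ψ g)⁻¹ := fun g hg =>
    ⟨localWithin_of_mem_wordBall ψ hc hg, by
      rw [← map_inv]; exact localWithin_of_mem_wordBall ψ hc (inv_mem_wordBall hg)⟩
  refine ⟨L, φ ∘ ψ, hL0, hL, fun g hg h hh hgh => hψ (hφ.1 (hmem g hg) (hmem h hh) hgh),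
    fun g hg h hh hgh => ?_⟩
  have := hφ.2 _ (hmem g hg) _ (hmem h hh) (by rw [← map_mul]; exact hmem _ hgh)
  rw [Function.comp_apply, map_mul, this]
  rfl

/-! ### The topological full group acts on an orbit -/

section Orbit

variable {A : Type*} [TopologicalSpace A]

theorem fullShift_zpow_apply (k : ℤ) (a : ℤ → A) (i : ℤ) : (fullShift A ^ k) a i = a (i + k) := by
  induction k generalizing a with
  | zero => simp
  | succ k ih =>
    rw [zpow_add_one]
    change (fullShift A ^ (k : ℤ)) (fullShift A a) i = _
    rw [ih]
    change a (i + k + 1) = _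
    rw [add_assoc]
  | pred k ih =>
    rw [zpow_sub_one]
    change (fullShift A ^ (-(k : ℤ))) ((fullShift A).symm a) i = _
    rw [ih]
    change a (i + -k - 1) = _
    rw [add_sub_assoc]

theorem subshift_zpow_apply {x : ℤ → A} (k : ℤ) (y : orbitClosure x) (i : ℤ) :
    ((subshift x ^ k) y).1 i = y.1 (i + k) := by
  induction k generalizing y with
  | zero => simp
  | succ k ih =>
    rw [zpow_add_one]
    change ((subshift x ^ (k : ℤ)) (subshift x y)).1 i = _
    rw [ih]
    change y.1 (i + k + 1) = _
    rw [add_assoc]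
  | pred k ih =>
    rw [zpow_sub_one]
    change ((subshift x ^ (-(k : ℤ))) ((subshift x).symm y)).1 i = _
    rw [ih]
    change y.1 (i + -k - 1) = _
    rw [add_sub_assoc]

/-- The point of the orbit of `x` obtained by shifting `x` by `k`. -/
def orbitPoint (x : ℤ → A) (k : ℤ) : orbitClosure x :=
  ⟨(fullShift A ^ k) x, subset_closure ⟨k, rfl⟩⟩

theorem orbitPoint_apply (x : ℤ → A) (k i : ℤ) : (orbitPoint x k).1 i = x (i + k) :=
  fullShift_zpow_apply k x i

theorem subshift_zpow_orbitPoint (x : ℤ → A) (k m : ℤ) :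
    (subshift x ^ m) (orbitPoint x k) = orbitPoint x (k + m) := by
  apply Subtype.ext
  funext i
  rw [subshift_zpow_apply, orbitPoint_apply, orbitPoint_apply]
  ring_nf

theorem orbitPoint_injective {x : ℤ → A} (hx : IsNonperiodic x) :
    Function.Injective (orbitPoint x) := by
  intro k l h
  by_contra hkl
  obtain ⟨i, hi⟩ := hx (k - l) (sub_ne_zero.2 hkl)
  have := congrArg (fun y : orbitClosure x => y.1 (i - l)) h
  simp only [orbitPoint_apply] at this
  refine hi ?_
  convert this using 2 <;> ring

theorem denseRange_orbitPoint (x : ℤ → A) : DenseRange (orbitPoint x) := by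
  intro y
  rw [closure_subtype]
  refine closure_mono ?_ y.2
  rintro _ ⟨k, rfl⟩
  exact ⟨orbitPoint x k, ⟨k, rfl⟩, rfl⟩

/-- The points of the subshift that agree with `y` on `[-n, n]`. -/
def coreSet {x : ℤ → A} (n : ℕ) (y : orbitClosure x) : Set (orbitClosure x) :=
  {z | ∀ i : ℤ, |i| ≤ n → z.1 i = y.1 i}

theorem orbitPoint_mem_coreSet {x : ℤ → A} {n : ℕ} {k l : ℤ} :
    orbitPoint x k ∈ coreSet n (orbitPoint x l) ↔ WindowEq x n k l := by
  change (∀ i : ℤ, |i| ≤ n → (orbitPoint x k).1 i = (orbitPoint x l).1 i) ↔ _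
  simp only [orbitPoint_apply, WindowEq, add_comm]

theorem isOpen_coreSet [DiscreteTopology A] {x : ℤ → A} (n : ℕ) (y : orbitClosure x) :
    IsOpen (coreSet n y) := by
  have h : coreSet n y = ⋂ i ∈ Finset.Icc (-(n : ℤ)) n, {z | z.1 i = y.1 i} := by
    ext z
    simp [coreSet, abs_le]
  rw [h]
  refine isOpen_biInter_finset fun i _ => ?_
  have hc : Continuous fun z : orbitClosure x => z.1 i :=
    (continuous_apply i).comp continuous_subtype_val
  exact (isOpen_discrete {y.1 i}).preimage hc

theorem exists_coreSet_subset {x : ℤ → A} {U : Set (orbitClosure x)} (hU : IsOpen U)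
    {y : orbitClosure x} (hy : y ∈ U) : ∃ n, coreSet n y ⊆ U := by
  obtain ⟨W, hW, rfl⟩ := isOpen_induced_iff.1 hU
  obtain ⟨I, u, hu, hsub⟩ := isOpen_pi_iff.1 hW y.1 hy
  refine ⟨I.sup Int.natAbs, fun z hz => hsub fun i hi => ?_⟩
  have hi' : i.natAbs ≤ I.sup Int.natAbs := Finset.le_sup hi
  rw [hz i (by rw [Int.abs_eq_natAbs]; exact_mod_cast hi')]
  exact (hu i hi).2

variable {x : ℤ → A}

/-- A continuous integer-valued function on the subshift depends on a window of bounded radius only. -/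
theorem exists_coreSet_const [DiscreteTopology A] [Finite A] {f : orbitClosure x → ℤ} (hf : Continuous f) :
    ∃ n, ∀ y, ∀ z ∈ coreSet n y, f z = f y := by
  have : CompactSpace (orbitClosure x) := isCompact_iff_compactSpace.1 isClosed_closure.isCompact
  let W : ℕ → Set (orbitClosure x) := fun n => {y | ∀ z ∈ coreSet n y, f z = f y}
  have hmono : Monotone W := fun n m hnm y hy z hz =>
    hy z fun i hi => hz i (hi.trans (by exact_mod_cast hnm))
  have hopen : ∀ n, IsOpen (W n) := fun n => by
    rw [isOpen_iff_forall_mem_open]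
    refine fun y hy => ⟨coreSet n y, fun z hz w hw => ?_, isOpen_coreSet n y, fun _ _ => rfl⟩
    rw [hy z hz, hy w fun i hi => (hw i hi).trans (hz i hi)]
  have hcov : Set.univ ⊆ ⋃ n, W n := fun y _ => by
    obtain ⟨n, hn⟩ := exists_coreSet_subset ((isOpen_discrete {f y}).preimage hf) (y := y) rfl
    exact Set.mem_iUnion.2 ⟨n, fun z hz => hn hz⟩
  obtain ⟨n, hn⟩ := isCompact_univ.elim_directed_cover W hopen hcov hmono.directed_le
  exact ⟨n, fun y => hn (Set.mem_univ y)⟩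

/-- The displacement of a local permutation extends continuously from the orbit to the subshift. -/
theorem exists_continuous_displacement [DiscreteTopology A] {n : ℕ} {π : Equiv.Perm ℤ} (hπ : LocalWithin x n π) :
    ∃ f : orbitClosure x → ℤ, Continuous f ∧ ∀ k, f (orbitPoint x k) = π k - k := by
  have hex : ∀ y : orbitClosure x, ∃ k, orbitPoint x k ∈ coreSet n y := fun y =>
    (denseRange_orbitPoint x).exists_mem_open (isOpen_coreSet n y) ⟨y, fun _ _ => rfl⟩
  choose κ hκ using hex
  have key : ∀ y, ∀ z ∈ coreSet n y, π (κ z) - κ z = π (κ y) - κ y := by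
    intro y z hz
    refine hπ.2 _ _ (orbitPoint_mem_coreSet.1 fun i hi => ?_)
    rw [hκ z i hi, hz i hi, hκ y i hi]
  refine ⟨fun y => π (κ y) - κ y, ?_, fun k => hπ.2 _ _ (orbitPoint_mem_coreSet.1 (hκ _))⟩
  refine IsLocallyConstant.continuous ((IsLocallyConstant.iff_exists_open _).2 fun y => ?_)
  exact ⟨_, isOpen_coreSet n y, fun _ _ => rfl, key y⟩

theorem continuous_subshift_zpow {f : orbitClosure x → ℤ} (hf : Continuous f) :
    Continuous fun y => (subshift x ^ f y) y := by
  refine continuous_iff_continuousAt.2 fun y => ?_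
  refine (subshift x ^ f y).continuous.continuousAt.congr ?_
  have : f ⁻¹' {f y} ∈ 𝓝 y := ((isOpen_discrete {f y}).preimage hf).mem_nhds rfl
  filter_upwards [this] with z hz
  rw [show f z = f y from hz]

/-- The topological full group acts on the orbit of `x`, hence on `ℤ`. -/
theorem exists_orbitHom (hx : IsNonperiodic x) :
    ∃ ψ : topologicalFullGroup (subshift x) →* Equiv.Perm ℤ,
      ∀ g k, g.1 (orbitPoint x k) = orbitPoint x (ψ g k) := by
  have hinj := orbitPoint_injective hx
  have hex : ∀ (g : topologicalFullGroup (subshift x)) (k : ℤ), ∃ l,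
      g.1 (orbitPoint x k) = orbitPoint x l := by
    rintro ⟨g, f, -, hgf⟩ k
    exact ⟨_, (hgf _).trans (subshift_zpow_orbitPoint x k _)⟩
  choose F hF using hex
  have hmul : ∀ g h k, F (g * h) k = F g (F h k) := fun g h k => hinj <| by
    rw [← hF, ← hF, ← hF]; rfl
  have hone : ∀ k, F 1 k = k := fun k => hinj <| by rw [← hF]; rfl
  let ψ : topologicalFullGroup (subshift x) → Equiv.Perm ℤ := fun g =>
    { toFun := F g
      invFun := F g⁻¹
      left_inv := fun k => by rw [← hmul, inv_mul_cancel, hone]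
      right_inv := fun k => by rw [← hmul, mul_inv_cancel, hone] }
  exact ⟨MonoidHom.mk' ψ fun g h => Equiv.ext fun k => hmul g h k, hF⟩

variable {ψ : topologicalFullGroup (subshift x) →* Equiv.Perm ℤ}

theorem orbitHom_injective [DiscreteTopology A]
    (hψ : ∀ g k, g.1 (orbitPoint x k) = orbitPoint x (ψ g k)) :
    Function.Injective ψ := by
  intro g h hgh
  have : T2Space A := inferInstance
  apply Subtype.ext
  apply Homeomorph.ext
  refine congrFun ((denseRange_orbitPoint x).equalizer g.1.continuous h.1.continuous ?_)
  funext k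
  simp only [Function.comp_apply, hψ, hgh]

theorem range_orbitHom [DiscreteTopology A] [Finite A] (hx : IsNonperiodic x)
    (hψ : ∀ g k, g.1 (orbitPoint x k) = orbitPoint x (ψ g k)) : ψ.range = localGroup x := by
  have hinj := orbitPoint_injective hx
  apply le_antisymm
  · rintro _ ⟨g, rfl⟩
    obtain ⟨f, hf, hgf⟩ := g.2
    have hdisp : ∀ k, ψ g k - k = f (orbitPoint x k) := fun k => by
      have h := (hψ g k).symm.trans ((hgf _).trans (subshift_zpow_orbitPoint x k _))
      rw [hinj h]; ring
    obtain ⟨n, hn⟩ := exists_coreSet_const hf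
    have hloc : ∀ k l, WindowEq x n k l → f (orbitPoint x k) = f (orbitPoint x l) :=
      fun k l hkl => hn _ _ (orbitPoint_mem_coreSet.2 hkl)
    obtain ⟨B, hB⟩ := ((finite_range_of_windowEq hloc).image Int.natAbs).bddAbove
    refine ⟨n + B, fun k => ?_, fun k l hkl => ?_⟩
    · rw [hdisp, Int.abs_eq_natAbs]
      have : (f (orbitPoint x k)).natAbs ≤ B := hB ⟨_, ⟨k, rfl⟩, rfl⟩
      omega
    · rw [hdisp, hdisp, hloc k l (hkl.mono (by omega))]
  · rintro π hπ
    obtain ⟨n, hn⟩ := hπ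
    obtain ⟨f, hf, hfπ⟩ := exists_continuous_displacement hn
    obtain ⟨f', hf', hfπ'⟩ := exists_continuous_displacement hn.inv
    have hc := continuous_subshift_zpow hf
    have hc' := continuous_subshift_zpow hf'
    have ho : ∀ k, (subshift x ^ f (orbitPoint x k)) (orbitPoint x k) = orbitPoint x (π k) :=
      fun k => by rw [hfπ, subshift_zpow_orbitPoint]; ring_nf
    have ho' : ∀ k, (subshift x ^ f' (orbitPoint x k)) (orbitPoint x k) = orbitPoint x (π⁻¹ k) :=
      fun k => by rw [hfπ', subshift_zpow_orbitPoint, add_sub_cancel]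
    let g : orbitClosure x ≃ₜ orbitClosure x :=
      { toFun := fun y => (subshift x ^ f y) y
        invFun := fun y => (subshift x ^ f' y) y
        left_inv := congrFun ((denseRange_orbitPoint x).equalizer (hc'.comp hc) continuous_id <| by
          funext k
          simp only [Function.comp_apply, ho, ho', perm_inv_apply_apply])
        right_inv := congrFun ((denseRange_orbitPoint x).equalizer (hc.comp hc') continuous_id <| by
          funext k
          simp only [Function.comp_apply, ho, ho', perm_apply_inv_apply])
        continuous_toFun := hc
        continuous_invFun := hc' }
    refine ⟨⟨g, f, hf, fun y => rfl⟩, Equiv.ext fun k => hinj ?_⟩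
    rw [← hψ]
    exact ho k

/-- The derived subgroup of the topological full group is isomorphic to the derived subgroup of the
group of local permutations. -/
theorem exists_derivedHom [DiscreteTopology A] [Finite A] (hx : IsNonperiodic x) :
    ∃ ψ : DerivedFullGroup x →* Equiv.Perm ℤ, Function.Injective ψ ∧
      ψ.range = ⁅localGroup x, localGroup x⁆ ∧ ∀ g, ψ g ∈ localGroup x := by
  obtain ⟨ψ, hψ⟩ := exists_orbitHom hx
  have hrange := range_orbitHom hx hψ
  refine ⟨ψ.comp (Subgroup.subtype _), (orbitHom_injective hψ).comp Subtype.val_injective, ?_,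
    fun g => hrange ▸ ⟨_, rfl⟩⟩
  rw [MonoidHom.range_comp, Subgroup.range_subtype, commutator_def, Subgroup.map_commutator,
    ← MonoidHom.range_eq_map, hrange]

end Orbit

/-! ### Growth estimates -/

theorem lettersModSeven_toeplitz (M : ℕ → ℕ) : LettersModSeven (toeplitz M) :=
  fun _ _ h => seven_dvd_of_toeplitz_eq M h

theorem hasPeriods_toeplitz {M : ℕ → ℕ} (hM : ∀ i, 1 ≤ M i) : HasPeriods (toeplitz M) := by
  refine fun L => ⟨period M L, 2 * period M (L + 1), lt_period M L, fun k l h => ?_⟩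
  exact period_dvd_of_toeplitz_eq M L (hM L) fun s hs =>
    h s (by rw [Nat.abs_cast]; exact_mod_cast hs)

theorem IsLocalEmbedding.mono {G Q : Type*} [Group G] [Group Q] {E F : Set G} {φ : G → Q}
    (h : IsLocalEmbedding F φ) (hEF : E ⊆ F) : IsLocalEmbedding E φ :=
  ⟨h.1.mono hEF, fun g hg k hk hgk => h.2 g (hEF hg) k (hEF hk) (hEF hgk)⟩

/-- A group whose balls embed locally into finite groups is LEF. -/
theorem isLEF_of_wordBall {G : Type*} [Group G] {S : Set G} (hS : Subgroup.closure S = ⊤)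
    (h : ∀ n, ∃ (Q : Type) (_ : Group Q) (_ : Finite Q) (φ : G → Q),
      IsLocalEmbedding (wordBall S n) φ) : IsLEF G := by
  intro F hF
  have hex : ∀ g : G, ∃ n, g ∈ wordBall S n := fun g =>
    exists_mem_wordBall (by rw [hS]; trivial)
  choose r hr using hex
  obtain ⟨n, hn⟩ := (hF.image r).bddAbove
  obtain ⟨Q, hQ, hfin, φ, hφ⟩ := h n
  exact ⟨Q, hQ, hfin, φ, hφ.mono fun g hg => wordBall_mono (hn ⟨g, hg, rfl⟩) (hr g)⟩

theorem lefGrowth_le {G : Type*} [Group G] {S : Set G} {n : ℕ} {Q : Type} [Group Q] [Finite Q]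
    {φ : G → Q} (h : IsLocalEmbedding (wordBall S n) φ) : lefGrowth S n ≤ Nat.card Q :=
  Nat.sInf_le ⟨Q, inferInstance, inferInstance, φ, h, rfl⟩

/-- In an LEF group the minimum that defines the LEF growth is attained. -/
theorem exists_card_eq_lefGrowth {G : Type*} [Group G] (hG : IsLEF G) {S : Set G} (hS : S.Finite)
    (n : ℕ) : ∃ (Q : Type) (_ : Group Q) (_ : Finite Q) (φ : G → Q),
      IsLocalEmbedding (wordBall S n) φ ∧ Nat.card Q = lefGrowth S n := by
  obtain ⟨Q, hQ, hfin, φ, hφ⟩ := hG _ (finite_wordBall hS n)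
  exact Nat.sInf_mem (s := {m : ℕ | ∃ (Q : Type) (_ : Group Q) (_ : Finite Q) (φ : G → Q),
    IsLocalEmbedding (wordBall S n) φ ∧ Nat.card Q = m}) ⟨_, Q, hQ, hfin, φ, hφ, rfl⟩

theorem complexity_mono {A : Type*} [Finite A] (x : ℤ → A) : Monotone (complexity x) := by
  intro m n hmn
  have h : factors x m ⊆ (fun w : Fin n → A => fun i : Fin m => w (Fin.castLE hmn i)) ''
      factors x n := by
    rintro v ⟨k, hk⟩
    exact ⟨fun i => x (k + (i : ℕ)), ⟨k, fun _ => rfl⟩, funext fun i => (hk i).symm⟩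
  exact (Set.ncard_le_ncard h (Set.toFinite _)).trans (Set.ncard_image_le (Set.toFinite _))

theorem factorial_le_exp_exp {L : ℕ} (hL : 0 < L) :
    (L.factorial : ℝ) ≤ Real.exp (Real.exp (2 * Real.log L)) := by
  have hL' : (0 : ℝ) < L := by exact_mod_cast hL
  have h1 : (L.factorial : ℝ) ≤ (L : ℝ) ^ L := by exact_mod_cast Nat.factorial_le_pow L
  refine h1.trans ?_
  rw [← Real.rpow_natCast, Real.rpow_def_of_pos hL']
  refine Real.exp_le_exp.2 ?_
  rw [two_mul, Real.exp_add, Real.exp_log hL']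
  have := Real.log_le_sub_one_of_pos hL'
  nlinarith

/-- An upper bound for the recurrence function gives one for the LEF growth. -/
theorem growthLE_lefGrowth_of_recurrence_le {A : Type*} {x : ℤ → A} (hx : IsUniformlyRecurrent x)
    {r C : ℝ} (hr : 0 ≤ r) (hC : 0 < C)
    (hrec : ∀ n : ℕ, 2 ≤ n → (recurrence x n : ℝ) ≤ Real.exp (C * Real.log n ^ r))
    {Γ : Type*} [Group Γ] {ψ : Γ →* Equiv.Perm ℤ} (hψ : Function.Injective ψ)
    (hloc : ∀ g, ψ g ∈ localGroup x) {S : Set Γ} (hS : S.Finite) :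
    GrowthLE (fun n => (lefGrowth S n : ℝ))
      (fun n => Real.exp (Real.exp ((2 * C + 2) * Real.log n ^ r))) := by
  obtain ⟨c, hc, h⟩ := exists_isLocalEmbedding_wordBall hx hψ hloc hS
  refine ⟨4 * c + 2, by omega, fun n hn => ?_⟩
  obtain ⟨L, φ, hL0, hL, hφ⟩ := h n
  have : NeZero L := ⟨hL0.ne'⟩
  have hgrowth : lefGrowth S n ≤ L.factorial := by
    have := lefGrowth_le hφ
    rwa [Nat.card_perm, Nat.card_zmod] at this
  have hcn : 1 ≤ c * n := Nat.mul_pos hc hn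
  set N := 4 * (c * n) + 1 with hN
  have hNK : N ≤ (4 * c + 2) * n := by rw [hN]; nlinarith
  have hR := hrec N (by omega)
  have hN1 : (1 : ℝ) ≤ N := by exact_mod_cast (by omega : 1 ≤ N)
  have hNK' : (N : ℝ) ≤ ((4 * c + 2) * n : ℕ) := by exact_mod_cast hNK
  have hlogN : Real.log N ≤ Real.log ((4 * c + 2) * n : ℕ) :=
    Real.log_le_log (by linarith) hNK'
  have hlog1 : 1 ≤ Real.log ((4 * c + 2) * n : ℕ) := by
    have h3 : (3 : ℝ) ≤ ((4 * c + 2) * n : ℕ) := by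
      refine le_trans ?_ hNK'
      exact_mod_cast (by omega : 3 ≤ N)
    rw [Real.le_log_iff_exp_le (by linarith)]
    linarith [Real.exp_one_lt_d9]
  have hL0' : (0 : ℝ) < L := by exact_mod_cast hL0
  have hL' : (L : ℝ) ≤ 2 * Real.exp (C * Real.log N ^ r) := by
    have : (L : ℝ) ≤ 2 * recurrence x N := by exact_mod_cast hL
    linarith
  have hlogL : Real.log L ≤ 1 + C * Real.log N ^ r := by
    have := Real.log_le_log hL0' hL'
    rw [Real.log_mul (by norm_num) (Real.exp_pos _).ne', Real.log_exp] at this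
    linarith [Real.log_two_lt_d9]
  have hpow : Real.log N ^ r ≤ Real.log ((4 * c + 2) * n : ℕ) ^ r :=
    Real.rpow_le_rpow (Real.log_nonneg hN1) hlogN hr
  have hone : 1 ≤ Real.log ((4 * c + 2) * n : ℕ) ^ r := Real.one_le_rpow hlog1 hr
  calc (lefGrowth S n : ℝ) ≤ L.factorial := by exact_mod_cast hgrowth
    _ ≤ Real.exp (Real.exp (2 * Real.log L)) := factorial_le_exp_exp hL0
    _ ≤ _ := by
      refine Real.exp_le_exp.2 (Real.exp_le_exp.2 ?_)
      nlinarith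

/-- A lower bound for the complexity, at arbitrarily long lengths, gives a lower bound for the
LEF growth. -/
theorem not_growthLE_lefGrowth_of_le_complexity {A : Type*} [Fintype A] {x : ℤ → A}
    (hx : LettersModSeven x) {r r' c : ℝ} (hr' : 0 ≤ r') (hrr : r' < r) (hc : 0 < c) {m : ℕ → ℕ}
    (hm : StrictMono m)
    (hcomp : ∀ i, 1 ≤ m i ∧ Real.exp (c * Real.log (m i) ^ r) ≤ (complexity x (m i) : ℝ))
    {Γ : Type*} [Group Γ] (hΓ : IsLEF Γ) {ψ : Γ →* Equiv.Perm ℤ} (hψ : Function.Injective ψ)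
    (hbase : baseCycs x ⊆ Set.range ψ) {S : Set Γ} (hfin : S.Finite)
    (hS : Subgroup.closure S = ⊤) {C : ℝ} (hC : 0 < C) :
    ¬ GrowthLE (fun n => (lefGrowth S n : ℝ))
      (fun n => Real.exp (Real.exp (C * Real.log n ^ r'))) := by
  rintro ⟨K, hK, hgrowth⟩
  obtain ⟨b, hb, hlow⟩ := exists_two_pow_le_card_of_isLocalEmbedding hx hψ hbase hS
  have : Nonempty A := ⟨x 0⟩
  have hA : (1 : ℝ) ≤ Fintype.card A := by exact_mod_cast Fintype.card_pos
  have hlog2 : 0 < Real.log 2 := Real.log_pos (by norm_num)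
  have hlog2' : Real.log 2 ≤ 1 := by linarith [Real.log_two_lt_d9]
  -- the constant that `log (m i) ^ (r - r')` has to beat
  set D := Real.log (Fintype.card A / Real.log 2) + C * 3 ^ r' with hD
  have hAlog : 0 ≤ Real.log (Fintype.card A / Real.log 2) :=
    Real.log_nonneg (by rw [le_div_iff₀ hlog2]; linarith)
  have htend : Filter.Tendsto (fun i => Real.log (m i)) Filter.atTop Filter.atTop :=
    Real.tendsto_log_atTop.comp (tendsto_natCast_atTop_atTop.comp hm.tendsto_atTop)
  have hev1 := htend.eventually_ge_atTop 1
  have hev2 := htend.eventually_ge_atTop (Real.log (4 * K * b))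
  have hev3 := ((tendsto_rpow_atTop (sub_pos.2 hrr)).comp htend).eventually_gt_atTop (D / c)
  obtain ⟨i, hi1, hi2, hi3⟩ := (hev1.and (hev2.and hev3)).exists
  obtain ⟨hm1, hcompi⟩ := hcomp i
  set ℓ := Real.log (m i) with hℓ
  -- a power of two of the order of magnitude of `m i`
  set s := Nat.log 2 (m i) + 1 with hs
  have hms : m i ≤ 2 ^ s := (Nat.lt_pow_succ_log_self (by norm_num) _).le
  have hsm : 2 ^ s ≤ 2 * m i := by
    rw [hs, pow_succ, mul_comm]
    exact Nat.mul_le_mul_left 2 (Nat.pow_log_le_self 2 (by omega))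
  obtain ⟨Q, _, _, φ, hφ, hQ⟩ := exists_card_eq_lefGrowth hΓ hfin (b * 4 ^ s)
  obtain ⟨q, hq1, hq2⟩ := hlow s (by omega) Q φ hφ
  have hup := hgrowth (b * 4 ^ s) (Nat.mul_pos hb (by positivity))
  have hm0 : (0 : ℝ) < m i := by exact_mod_cast hm1
  have hlogarg : Real.log ((K * (b * 4 ^ s) : ℕ) : ℝ) ≤ 3 * ℓ := by
    have h4 : 4 ^ s ≤ 4 * m i ^ 2 := by
      calc 4 ^ s = (2 ^ s) ^ 2 := by rw [← pow_mul, mul_comm, pow_mul]; norm_num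
        _ ≤ (2 * m i) ^ 2 := Nat.pow_le_pow_left hsm 2
        _ = 4 * m i ^ 2 := by ring
    have hle : K * (b * 4 ^ s) ≤ 4 * K * b * m i ^ 2 := by
      calc K * (b * 4 ^ s) ≤ K * (b * (4 * m i ^ 2)) :=
            Nat.mul_le_mul_left _ (Nat.mul_le_mul_left _ h4)
        _ = _ := by ring
    have hpos : 0 < K * (b * 4 ^ s) := Nat.mul_pos hK (Nat.mul_pos hb (by positivity))
    have h1 := Real.log_le_log (by exact_mod_cast hpos)
      (show ((K * (b * 4 ^ s) : ℕ) : ℝ) ≤ 4 * K * b * (m i : ℝ) ^ 2 by exact_mod_cast hle)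
    have hK' : (K : ℝ) ≠ 0 := by exact_mod_cast hK.ne'
    have hb' : (b : ℝ) ≠ 0 := by exact_mod_cast hb.ne'
    rw [Real.log_mul (by positivity) (by positivity), Real.log_pow] at h1
    push_cast at h1 hi2 ⊢
    linarith
  have hlogarg0 : 0 ≤ Real.log ((K * (b * 4 ^ s) : ℕ) : ℝ) := Real.log_natCast_nonneg _
  have hq3 : q * Real.log 2 ≤ Real.exp (C * 3 ^ r' * ℓ ^ r') := by
    have h1 : (2 : ℝ) ^ q ≤ Real.exp (Real.exp (C * Real.log ((K * (b * 4 ^ s) : ℕ) : ℝ) ^ r')) := by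
      refine le_trans ?_ hup
      change (2 : ℝ) ^ q ≤ (lefGrowth S (b * 4 ^ s) : ℝ)
      rw [← hQ]
      exact_mod_cast hq2
    have h2 := Real.log_le_log (by positivity) h1
    rw [Real.log_pow, Real.log_exp] at h2
    refine h2.trans (Real.exp_le_exp.2 ?_)
    rw [mul_assoc, ← Real.mul_rpow (by norm_num) (by linarith)]
    exact mul_le_mul_of_nonneg_left (Real.rpow_le_rpow hlogarg0 hlogarg hr') hC.le
  have hq4 : Real.exp (c * ℓ ^ r) ≤ Fintype.card A / Real.log 2 * Real.exp (C * 3 ^ r' * ℓ ^ r') := by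
    have h1 : (complexity x (m i) : ℝ) ≤ Fintype.card A * q := by
      exact_mod_cast (complexity_mono x hms).trans hq1
    rw [div_mul_eq_mul_div, le_div_iff₀ hlog2]
    have h2 := hcompi.trans h1
    calc Real.exp (c * ℓ ^ r) * Real.log 2 ≤ Fintype.card A * q * Real.log 2 :=
          mul_le_mul_of_nonneg_right h2 hlog2.le
      _ = Fintype.card A * (q * Real.log 2) := by ring
      _ ≤ _ := mul_le_mul_of_nonneg_left hq3 (by linarith)
  have hq5 : c * ℓ ^ r ≤ Real.log (Fintype.card A / Real.log 2) + C * 3 ^ r' * ℓ ^ r' := by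
    have h1 := Real.log_le_log (Real.exp_pos _) hq4
    rwa [Real.log_exp, Real.log_mul (by positivity) (Real.exp_pos _).ne', Real.log_exp] at h1
  have hℓ1 : 1 ≤ ℓ ^ r' := Real.one_le_rpow hi1 hr'
  have hsplit : ℓ ^ r = ℓ ^ r' * ℓ ^ (r - r') := by
    rw [← Real.rpow_add (by linarith)]; ring_nf
  have hi3' : D < c * ℓ ^ (r - r') := by
    have : D / c < ℓ ^ (r - r') := hi3
    rwa [div_lt_iff₀ hc, mul_comm] at this
  have h1 : D * ℓ ^ r' < c * ℓ ^ r := by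
    rw [hsplit]
    nlinarith
  have h2 : Real.log (Fintype.card A / Real.log 2) + C * 3 ^ r' * ℓ ^ r' ≤ D * ℓ ^ r' := by
    rw [hD, add_mul]
    nlinarith
  linarith

theorem mainTheorem4 (r : ℝ) (hr : 2 ≤ r) :
    ∃ (k : ℕ) (x : ℤ → Fin k), 2 ≤ k ∧ IsUniformlyRecurrent x ∧ IsNonperiodic x ∧
      -- growth of the recurrence and complexity functions of the minimal subshift `X_r`
      (∃ C : ℝ, 0 < C ∧ ∀ n : ℕ, 2 ≤ n →
        (recurrence x n : ℝ) ≤ Real.exp (C * Real.log n ^ r)) ∧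
      (∃ (c : ℝ) (m : ℕ → ℕ), 0 < c ∧ StrictMono m ∧ ∀ i : ℕ, 1 ≤ m i ∧
        Real.exp (c * Real.log (m i) ^ r) ≤ (complexity x (m i) : ℝ)) ∧
      -- the group
      Group.FG (DerivedFullGroup x) ∧ IsLEF (DerivedFullGroup x) ∧
      (∃ C : ℝ, 0 < C ∧ ∀ S : Set (DerivedFullGroup x), S.Finite → Subgroup.closure S = ⊤ →
        GrowthLE (fun n => (lefGrowth S n : ℝ))
          (fun n => Real.exp (Real.exp (C * Real.log n ^ r)))) ∧
      (∀ r' : ℝ, 2 ≤ r' → r' < r → ∀ C : ℝ, 0 < C →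
        ∀ S : Set (DerivedFullGroup x), S.Finite → Subgroup.closure S = ⊤ →
          ¬ GrowthLE (fun n => (lefGrowth S n : ℝ))
            (fun n => Real.exp (Real.exp (C * Real.log n ^ r')))) := by
  have hM : ∀ i, 1 ≤ blockParam r i := fun i => le_trans (by norm_num) (two_le_blockParam hr i)
  have hrec := isUniformlyRecurrent_toeplitz hr
  have hper := isNonperiodic_toeplitz hr
  have h7 := lettersModSeven_toeplitz (blockParam r)
  obtain ⟨C, hC, hR⟩ := recurrence_toeplitz_le hr
  obtain ⟨c, m, hc, hm, hcomp⟩ := complexity_toeplitz_ge hr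
  obtain ⟨ψ, hψ, hrange, hloc⟩ := exists_derivedHom hper
  rw [commutator_localGroup_eq h7 (hasPeriods_toeplitz hM)] at hrange
  have hbase : baseCycs (toeplitz (blockParam r)) ⊆ Set.range ψ := by
    rw [← MonoidHom.coe_range, hrange]
    exact Subgroup.subset_closure
  have hFG : Group.FG (DerivedFullGroup (toeplitz (blockParam r))) := by
    have h1 : ψ.range.FG := by
      rw [hrange]
      exact (Subgroup.fg_iff _).2 ⟨_, rfl, finite_baseCycs⟩
    have h2 : Group.FG ψ.range := (Group.fg_iff_subgroup_fg _).2 h1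
    exact Group.fg_of_surjective (f := (MonoidHom.ofInjective hψ).symm.toMonoidHom)
      (MonoidHom.ofInjective hψ).symm.surjective
  have hLEF : IsLEF (DerivedFullGroup (toeplitz (blockParam r))) := by
    obtain ⟨S, hS, hSfin⟩ := Group.fg_iff.1 hFG
    obtain ⟨b, -, hb⟩ := exists_isLocalEmbedding_wordBall hrec hψ hloc hSfin
    refine isLEF_of_wordBall hS fun n => ?_
    obtain ⟨L, φ, hL, -, hφ⟩ := hb n
    have : NeZero L := ⟨hL.ne'⟩
    exact ⟨Equiv.Perm (ZMod L), inferInstance, inferInstance, φ, hφ⟩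
  refine ⟨8, toeplitz (blockParam r), by norm_num, hrec, hper, ⟨C, hC, hR⟩, ⟨c, m, hc, hm, hcomp⟩,
    hFG, hLEF, ⟨2 * C + 2, by linarith, fun S hS _ => ?_⟩, fun r' hr' hrr C' hC' S hS hgen => ?_⟩
  · exact growthLE_lefGrowth_of_recurrence_le hrec (by linarith) hC hR hψ hloc hS
  · exact not_growthLE_lefGrowth_of_le_complexity h7 (by linarith) hrr hc hm hcomp hLEF hψ hbase hS
      hgen hC'
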